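/- **Violation heaps.** A violation heap is a list of node-disjoint heap-ordered multiary trees whose first root has minimum key. Every node stores a key and an integer rank. The children of a node are ordered by the time at which they were linked to it; the last two children of a node are called active. The rank of a node is recalculated by the formula $$r \leftarrow \lceil (r_1+r_2)/2\rceil+1,$$ where $r_1,r_2$ are the ranks of its active children and a missing child has rank $-1$. A 3-way-join of three trees of equal rank takes the root $z$ with a smallest key, arranges the active children of $z$ so that the one with the larger rank is last, makes the two other roots the last two children of $z$, and increments the rank of $z$. The operations are as follows. - *find-min*: return the first root. - *insert*: put a new single node of rank $0$ in the root list, in the first position if its key is smaller than the minimum, and otherwise in the second position. - *meld* (of two different heaps): combine the root lists, the first root being the smaller of the two first roots. - *decrease-key* (of a stored node $x$ by $\delta\ge 0$, given a pointer to $x$): subtract $\delta$ from the key of $x$. If $x$ is a root, make it the first root if its new key is smaller than the minimum, and stop. If $x$ is active and its new key is not smaller than that of its parent, stop. Otherwise cut the subtree of $x$, put in its position the subtree of that active child of $x$ which has the larger rank (nothing, if $x$ has no children), recalculate the rank of $x$, and make the subtree of $x$ a tree of the heap (first if its key is smaller than the minimum). Then, starting at the old position of $x$: as long as the current position is active, visit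 its parent; if the recalculated rank of the parent is smaller than its stored rank, update it and continue from the parent, otherwise stop. - *delete-min*: remove the first root, make each of its subtrees a tree of the heap, repeatedly 3-way-join trees of equal rank, using an array indexed by rank, until no three trees have the same rank, and move the root with the minimum key to the first position. All ties and unspecified orders may be resolved arbitrarily. Time is the number of elementary steps, each of which examines or changes a bounded number of keys, ranks, array cells and pointers. **Theorem.** Violation heaps support find-min, insert, meld and decrease-key in $O(1)$ amortized time, and delete-min in $O(\log n)$ amortized time. That is, there is a constant $C$ such that for every sequence of admissible operations on a collection of heaps that are empty at the beginning: every operation has the effect and the result that are required of a priority queue, every further admissible operation can be performed, and the total time of the sequence is at most the sum of its amortized costs, which are $C$ for each find-min, insert, meld and decrease-key, and $C\,(1+\log n)$ for each delete-min performed on a heap with $n$ elements. -/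

import Mathlib

universe u

namespace ViolationHeap

/-! ### Structure -/

/-- A multiary tree. Every node stores its identity (the handle by which the user refers to it),
its key, its rank, and the list of its children ordered by linking time, where the head of the
list is the LAST child (the one linked most recently). -/
inductive VTree (K : Type u) : Type u
  | node (elt : ℕ) (key : K) (rank : ℕ) (children : List (VTree K)) : VTree K

namespace VTree

variable {K : Type u}

def elt : VTree K → ℕ
  | node e _ _ _ => e

def key : VTree K → K
  | node _ k _ _ => k

def rank : VTree K → ℕ
  | node _ _ r _ => r

def children : VTree K → List (VTree K)
  | node _ _ _ cs => cs

/-- All pairs (element, key) stored in the tree. -/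
def nodes : VTree K → List (ℕ × K)
  | node e k _ cs => (e, k) :: cs.flatMap nodes

end VTree

/-- A heap is its list of tree roots, the first of which is meant to have minimum key. -/
abbrev Heap (K : Type u) : Type u := List (VTree K)

section Basics

variable {K : Type u}

/-- The multiset of all pairs (element, key) stored in a heap. -/
def contents (h : Heap K) : Multiset (ℕ × K) := (h.flatMap VTree.nodes : List (ℕ × K))

/-- The number of nodes of a heap. -/
def size (h : Heap K) : ℕ := (contents h).card

/-- The element `x` is stored in the heap `h`. -/
def Stored (x : ℕ) (h : Heap K) : Prop := ∃ k, (x, k) ∈ contents h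

/-- The rank of the child in position `i`, counted from the last child, which has position `0`.
The rank of a missing child is `-1`. -/
def rankAt (cs : List (VTree K)) (i : ℕ) : ℤ :=
  match cs[i]? with
  | some t => (t.rank : ℤ)
  | none => -1

/-- The recalculated rank `⌈(r₁ + r₂) / 2⌉ + 1` of a node with list of children `cs`, where `r₁`
and `r₂` are the ranks of its active children, that is, of its last two children. Since
`r₁ + r₂ ≥ -2` this integer is never negative, so that `Int.toNat` does not truncate. -/
def recalc (cs : List (VTree K)) : ℕ :=
  (⌈((rankAt cs 0 + rankAt cs 1 : ℤ) : ℚ) / 2⌉ + 1).toNat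

end Basics

/-! ### The 3-way-join and the consolidation -/

section Join

variable {K : Type u}

/-- The children are rearranged, if necessary, so that the active child with the larger rank is
the last child (either order is allowed if both ranks are equal). -/
inductive Arranged : List (VTree K) → List (VTree K) → Prop
  | few (cs : List (VTree K)) : cs.length ≤ 1 → Arranged cs cs
  | keep (a b : VTree K) (l : List (VTree K)) :
      b.rank ≤ a.rank → Arranged (a :: b :: l) (a :: b :: l)
  | swap (a b : VTree K) (l : List (VTree K)) :
      a.rank ≤ b.rank → Arranged (a :: b :: l) (b :: a :: l)

/-- `Join a b c w`: a 3-way-join of the trees `a`, `b`, `c`, which have equal ranks, may produce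
the tree `w`. One of the three trees, `z`, has a root key that is not larger than those of the
other two, `z₁` and `z₂`, which become the last two children of `z`; the rank of `z` is
incremented. -/
inductive Join [LE K] : VTree K → VTree K → VTree K → VTree K → Prop
  | mk (a b c z z₁ z₂ : VTree K) (cs : List (VTree K)) :
      [a, b, c].Perm [z, z₁, z₂] →
      z₁.rank = z.rank → z₂.rank = z.rank →
      z.key ≤ z₁.key → z.key ≤ z₂.key →
      Arranged z.children cs →
      Join a b c (VTree.node z.elt z.key (z.rank + 1) (z₁ :: z₂ :: cs))

/-- `Consolidate ts A A' c`: starting with the array `A` (indexed by rank values, each cell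
holding at most two trees of that rank) and the list `ts` of trees that still have to be entered,
the consolidation ends with the array `A'` after `c` elementary steps. The elementary steps are:
appending an empty cell to the array; storing the next tree in its cell; and, if that cell
already holds two trees, emptying it and joining the three trees, where the resulting tree is to
be entered next. -/
inductive Consolidate [LE K] :
    List (VTree K) → List (List (VTree K)) → List (List (VTree K)) → ℕ → Prop
  | done (A : List (List (VTree K))) : Consolidate [] A A 0
  | grow (t : VTree K) (ts : List (VTree K)) (A A' : List (List (VTree K))) (c : ℕ) :
      A.length ≤ t.rank →
      Consolidate (t :: ts) (A ++ [[]]) A' c →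
      Consolidate (t :: ts) A A' (c + 1)
  | place (t : VTree K) (ts b : List (VTree K)) (A A' : List (List (VTree K))) (c : ℕ) :
      A[t.rank]? = some b → b.length < 2 →
      Consolidate ts (A.set t.rank (t :: b)) A' c →
      Consolidate (t :: ts) A A' (c + 1)
  | join (t v₁ v₂ w : VTree K) (ts : List (VTree K)) (A A' : List (List (VTree K))) (c : ℕ) :
      A[t.rank]? = some [v₁, v₂] → Join t v₁ v₂ w →
      Consolidate (w :: ts) (A.set t.rank []) A' c →
      Consolidate (t :: ts) A A' (c + 1)

end Join

/-! ### Positions inside a tree, and the propagation of rank updates -/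

/-- One level of the path from a node up to the root: the data of the parent together with the
siblings of the node, `newer` being those linked after it and `older` those linked before it
(both lists with the most recently linked one first). -/
structure Frame (K : Type u) : Type u where
  elt : ℕ
  key : K
  rank : ℕ
  newer : List (VTree K)
  older : List (VTree K)

section Position

variable {K : Type u}

/-- The position is active: it is one of the last two positions among the siblings. -/
def Frame.Active (f : Frame K) : Prop := f.newer.length < 2

instance (f : Frame K) : Decidable f.Active := inferInstanceAs (Decidable (_ < _))

/-- The list of children that results from putting `seg` (one tree or none) in the position. -/
def Frame.kids (f : Frame K) (seg : List (VTree K)) : List (VTree K) := f.newer ++ seg ++ f.older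

/-- The parent with `seg` in the position, its rank being unchanged. -/
def Frame.fill (f : Frame K) (seg : List (VTree K)) : VTree K :=
  VTree.node f.elt f.key f.rank (f.kids seg)

/-- The whole tree that has the subtree `t` in the position given by the path (innermost frame
first). -/
def plug : VTree K → List (Frame K) → VTree K
  | t, [] => t
  | t, f :: fs => plug (f.fill [t]) fs

/-- Put `seg` in the position given by the path and propagate the rank updates upwards: as long
as the current position is active, its parent is visited; if the recalculated rank of the parent
is smaller than its stored rank, then the stored rank is replaced and the traversal goes on from
the parent, otherwise it stops. The result is the new tree and the number of visited nodes. -/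
def climb : List (VTree K) → List (Frame K) → List (VTree K) × ℕ
  | seg, [] => (seg, 0)
  | seg, f :: fs =>
    if f.Active then
      if recalc (f.kids seg) < f.rank then
        let p := climb [VTree.node f.elt f.key (recalc (f.kids seg)) (f.kids seg)] fs
        (p.1, p.2 + 1)
      else ([plug (f.fill seg) fs], 1)
    else ([plug (f.fill seg) fs], 0)

/-- `Detach cs seg rest`: among the children `cs` of a node, the active child with the larger rank
(either one if both ranks are equal) is detached; it forms `seg`, and `rest` is what remains.
A node without children has nothing to detach. -/
inductive Detach : List (VTree K) → List (VTree K) → List (VTree K) → Prop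
  | none : Detach [] [] []
  | only (a : VTree K) : Detach [a] [a] []
  | last (a b : VTree K) (l : List (VTree K)) :
      b.rank ≤ a.rank → Detach (a :: b :: l) [a] (b :: l)
  | second (a b : VTree K) (l : List (VTree K)) :
      a.rank ≤ b.rank → Detach (a :: b :: l) [b] (a :: l)

end Position

/-! ### The operations on heaps

Time is counted in elementary steps. An elementary step is straight-line code that examines or
changes a bounded number of keys, ranks, array cells and pointers (sibling pointers, pointer to the
last child, pointer from a last child to its parent, next pointers of the circular root list). -/

section Operations

variable {K : Type u}

/-- Put a tree in the root list: in the first position if its key is smaller than the minimum of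
the heap, otherwise in the second position. -/
def addRoot [LinearOrder K] (t : VTree K) : Heap K → Heap K
  | [] => [t]
  | f :: fs => if t.key < f.key then t :: f :: fs else f :: t :: fs

/-- `Meld h₁ h₂ h`: the root lists are combined, and the first root is the smaller one of the two
first roots. -/
inductive Meld [LE K] : Heap K → Heap K → Heap K → Prop
  | nil_left (h : Heap K) : Meld [] h h
  | nil_right (h : Heap K) : Meld h [] h
  | left (a b : VTree K) (as bs : List (VTree K)) :
      a.key ≤ b.key → Meld (a :: as) (b :: bs) (a :: (as ++ b :: bs))
  | right (a b : VTree K) (as bs : List (VTree K)) :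
      b.key ≤ a.key → Meld (a :: as) (b :: bs) (b :: (bs ++ a :: as))

/-- `DecreaseKey δ x h c h'`: the operation decrease-key with arguments `δ`, `x`, `h` may turn the
heap `h` into `h'`, in `c` elementary steps. -/
inductive DecreaseKey [AddGroup K] [LinearOrder K] (δ : K) (x : ℕ) :
    Heap K → ℕ → Heap K → Prop
  /-- `x` is a root, and its new key is smaller than the minimum: it becomes the first root. -/
  | root_first (h pre post : Heap K) (k : K) (r : ℕ) (cs : List (VTree K)) :
      h = pre ++ VTree.node x k r cs :: post →
      (∃ f ∈ h.head?, k - δ < f.key) →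
      DecreaseKey δ x h 1 (VTree.node x (k - δ) r cs :: (pre ++ post))
  /-- `x` is a root, and its new key is not smaller than the minimum. -/
  | root_stay (h pre post : Heap K) (k : K) (r : ℕ) (cs : List (VTree K)) :
      h = pre ++ VTree.node x k r cs :: post →
      (∃ f ∈ h.head?, f.key ≤ k - δ) →
      DecreaseKey δ x h 1 (pre ++ VTree.node x (k - δ) r cs :: post)
  /-- `x` is active, and its new key is not smaller than the key of its parent. -/
  | unmoved (h pre post : Heap K) (k : K) (r : ℕ) (cs : List (VTree K))
      (f : Frame K) (fs : List (Frame K)) :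
      h = pre ++ plug (VTree.node x k r cs) (f :: fs) :: post →
      f.Active → f.key ≤ k - δ →
      DecreaseKey δ x h 1 (pre ++ plug (VTree.node x (k - δ) r cs) (f :: fs) :: post)
  /-- In all other cases the subtree of `x` is cut, the subtree of its active child with the
  larger rank is glued in its position, the rank of `x` is recalculated, the subtree of `x` is
  made a tree of the heap, and the rank updates are propagated. -/
  | cut (h pre post : Heap K) (k : K) (r : ℕ) (cs seg rest : List (VTree K))
      (f : Frame K) (fs : List (Frame K)) :
      h = pre ++ plug (VTree.node x k r cs) (f :: fs) :: post →
      ¬ (f.Active ∧ f.key ≤ k - δ) →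
      Detach cs seg rest →
      DecreaseKey δ x h (1 + (climb seg (f :: fs)).2)
        (addRoot (VTree.node x (k - δ) (recalc rest) rest)
          (pre ++ (climb seg (f :: fs)).1 ++ post))

/-- `DeleteMin h z c h'`: the operation delete-min may remove the first root `z` of `h` and turn
`h` into `h'`, in `c` elementary steps: one for removing `z`, one for each subtree of `z` that is
made a tree of the heap, those of the consolidation (the trees being entered in any order), one
for each array cell when the array is read, and one for each remaining root when the new minimum
is searched and moved to the first position. -/
inductive DeleteMin [LE K] : Heap K → VTree K → ℕ → Heap K → Prop
  | mk (z : VTree K) (hs ts : List (VTree K)) (A : List (List (VTree K))) (c : ℕ) (h' : Heap K) :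
      ts.Perm (z.children ++ hs) →
      Consolidate ts [] A c →
      h'.Perm A.flatten →
      (∀ m ∈ h'.head?, ∀ t ∈ h', m.key ≤ t.key) →
      DeleteMin (z :: hs) z (1 + z.children.length + c + A.length + h'.length) h'

end Operations

/-! ### Sequences of operations on a collection of heaps -/

/-- The operations; heaps are referred to by names in `ℕ`, and so are elements. -/
inductive Op (K : Type u) : Type u
  | findMin (h : ℕ) : Op K
  | insert (h x : ℕ) (k : K) : Op K
  | meld (h₁ h₂ : ℕ) : Op K
  | decreaseKey (h x : ℕ) (δ : K) : Op K
  | deleteMin (h : ℕ) : Op K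

/-- A collection of heaps, indexed by their names. -/
abbrev Store (K : Type u) : Type u := ℕ → Heap K

section Sequences

variable {K : Type u}

/-- The operation may be asked for: find-min and delete-min need a nonempty heap, the inserted
element must be new, the two heaps that are melded must be different, and a key can only be
decreased (by `δ ≥ 0`) if the element is stored in the heap. -/
def Op.Admissible [Zero K] [LE K] (σ : Store K) : Op K → Prop
  | .findMin h => σ h ≠ []
  | .insert _ x _ => ∀ g, ¬ Stored x (σ g)
  | .meld h₁ h₂ => h₁ ≠ h₂
  | .decreaseKey h x δ => Stored x (σ h) ∧ 0 ≤ δ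
  | .deleteMin h => σ h ≠ []

/-- `Step σ op out c σ'`: the admissible operation `op` may turn the collection `σ` into `σ'` in
`c` elementary steps, returning `out` (the minimum, for find-min and delete-min). Melding stores
the result under the first name and leaves the empty heap under the second one. -/
inductive Step [AddGroup K] [LinearOrder K] :
    Store K → Op K → Option (ℕ × K) → ℕ → Store K → Prop
  | findMin (σ : Store K) (h : ℕ) (t : VTree K) (ts : List (VTree K)) :
      σ h = t :: ts →
      Step σ (.findMin h) (some (t.elt, t.key)) 1 σ
  | insert (σ : Store K) (h x : ℕ) (k : K) :
      (Op.insert h x k).Admissible σ →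
      Step σ (.insert h x k) none 1
        (Function.update σ h (addRoot (VTree.node x k 0 []) (σ h)))
  | meld (σ : Store K) (h₁ h₂ : ℕ) (h : Heap K) :
      (Op.meld h₁ h₂ : Op K).Admissible σ →
      Meld (σ h₁) (σ h₂) h →
      Step σ (.meld h₁ h₂) none 1 (Function.update (Function.update σ h₁ h) h₂ [])
  | decreaseKey (σ : Store K) (h x : ℕ) (δ : K) (c : ℕ) (h' : Heap K) :
      (Op.decreaseKey h x δ).Admissible σ →
      DecreaseKey δ x (σ h) c h' →
      Step σ (.decreaseKey h x δ) none c (Function.update σ h h')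
  | deleteMin (σ : Store K) (h : ℕ) (z : VTree K) (c : ℕ) (h' : Heap K) :
      DeleteMin (σ h) z c h' →
      Step σ (.deleteMin h) (some (z.elt, z.key)) c (Function.update σ h h')

/-- What a priority queue has to do when `op` is performed: the effect on the stored elements and
keys, and the returned value. -/
def Op.Correct [Sub K] [LE K] (σ : Store K) (out : Option (ℕ × K)) (σ' : Store K) :
    Op K → Prop
  | .findMin h =>
      σ' = σ ∧ ∃ p ∈ contents (σ h), out = some p ∧ ∀ q ∈ contents (σ h), p.2 ≤ q.2
  | .insert h x k =>
      contents (σ' h) = (x, k) ::ₘ contents (σ h) ∧ ∀ g, g ≠ h → σ' g = σ g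
  | .meld h₁ h₂ =>
      contents (σ' h₁) = contents (σ h₁) + contents (σ h₂) ∧ contents (σ' h₂) = 0 ∧
        ∀ g, g ≠ h₁ → g ≠ h₂ → σ' g = σ g
  | .decreaseKey h x δ =>
      (∃ k s, contents (σ h) = (x, k) ::ₘ s ∧ contents (σ' h) = (x, k - δ) ::ₘ s) ∧
        ∀ g, g ≠ h → σ' g = σ g
  | .deleteMin h =>
      (∃ p, out = some p ∧ contents (σ h) = p ::ₘ contents (σ' h) ∧
        ∀ q ∈ contents (σ h), p.2 ≤ q.2) ∧
        ∀ g, g ≠ h → σ' g = σ g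

/-- The amortized cost that is claimed for the operation, up to a constant factor: `1 + log n` for
delete-min on a heap with `n` elements, and `1` for all other operations. -/
noncomputable def Op.amortized (σ : Store K) : Op K → ℝ
  | .deleteMin h => 1 + Real.log (size (σ h))
  | .findMin _ | .insert _ _ _ | .meld _ _ | .decreaseKey _ _ _ => 1

/-- `m` operations `op 0, …, op (m - 1)` performed one after the other, starting with empty heaps:
`σ i` is the collection of heaps before operation number `i`, which takes `cost i` elementary
steps and returns `out i`. -/
def IsRun [AddGroup K] [LinearOrder K] (m : ℕ) (σ : ℕ → Store K) (op : ℕ → Op K)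
    (out : ℕ → Option (ℕ × K)) (cost : ℕ → ℕ) : Prop :=
  (∀ h, σ 0 h = []) ∧ ∀ i < m, Step (σ i) (op i) (out i) (cost i) (σ (i + 1))

end Sequences

end ViolationHeap

/-! The proof uses the potential method. Every root carries 3 units, and every node carries a
potential that depends only on its rank `r` and the ranks of its children. Write `s` for the sum of
the ranks of its active children. The invariant `Valid` is heap order together with `2r ≤ s + 3`,
that is, no rank exceeds its recalculated value. It makes the size of a tree exponential in its rank
(`Valid.pow_rank_le`), so ranks and array lengths are logarithmic.

The first part of the node potential pays for the propagation in decrease-key. It is 17 if `2r = s +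
3`, when the rank was rounded up as far as possible, and 0 otherwise. The subtree that takes the
place of a cut node has rank smaller by at most one, so `s` drops by at most one. Hence a parent has
to be updated only if `2r = s + 3` held. Its rank then falls by exactly one and is no longer rounded
up, so 17 units are released, and the grandparent is in the same situation (`nodePotential_update`,
`climb_spec`).

The second part, `surplus`, pays delete-min for the children of the removed root, whose number need
not be bounded by a multiple of the rank, since cuts can lower ranks without removing older
children. It is the minimum over `N ≤ r` of 4 per child beyond `2N` plus 8 per unit by which the
ranks, from the last child on, stay below `N - 1, N - 2, …`. A join adds two children of rank `r`
and raises the rank by one, which `N + 1` absorbs (`nodePotential_link`). Replacing a child, or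
lowering the rank by one, costs at most 8 each. Detaching an active child costs at most 12 even if
the rank collapses: it collapses only because the next active children have small rank, and their
deficit has already been charged (`surplus_unlink`).

In delete-min the surplus and a multiple of the rank pay for making the children roots. The 3 units
per root pay for entering trees into the array, and what remains is proportional to the array length
(`DeleteMin.cost_le`). -/

namespace ViolationHeap

/-! ### Ranks of children -/

/-- The sum of the ranks of the two active children, given the ranks of all children. -/
def activeSum : List ℕ → ℤ
  | [] => -2
  | [a] => a - 1
  | a :: b :: _ => a + b

theorem rankAt_add_rankAt {K : Type u} (cs : List (VTree K)) :
    rankAt cs 0 + rankAt cs 1 = activeSum (cs.map VTree.rank) := by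
  rcases cs with _ | ⟨a, _ | ⟨b, l⟩⟩ <;> simp [rankAt, activeSum]
  ring

theorem neg_two_le_activeSum (l : List ℕ) : -2 ≤ activeSum l := by
  rcases l with _ | ⟨a, _ | ⟨b, l⟩⟩ <;> simp [activeSum] <;> omega

theorem recalc_bounds {K : Type u} (cs : List (VTree K)) :
    activeSum (cs.map VTree.rank) + 2 ≤ 2 * (recalc cs : ℤ) ∧
      2 * (recalc cs : ℤ) ≤ activeSum (cs.map VTree.rank) + 3 := by
  have h := neg_two_le_activeSum (cs.map VTree.rank)
  rw [recalc, rankAt_add_rankAt]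
  set s := activeSum (cs.map VTree.rank)
  have h1 := Int.le_ceil ((s : ℚ) / 2)
  have h2 := Int.ceil_lt_add_one ((s : ℚ) / 2)
  set q := ⌈(s : ℚ) / 2⌉
  have h3 : s ≤ 2 * q := by
    have : (s : ℚ) ≤ 2 * q := by linarith
    exact_mod_cast this
  have h4 : 2 * q < s + 2 := by
    have : 2 * (q : ℚ) < s + 2 := by linarith
    exact_mod_cast this
  omega

/-- The relation between the rank `c` of a child and the list of the ranks of the trees (one or
none) that replace it: the rank drops by at most one, where a missing child has rank `-1`. -/
def Replaces (c : ℕ) (seg : List ℕ) : Prop :=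
  (seg = [] ∧ c = 0) ∨ ∃ c', seg = [c'] ∧ c ≤ c' + 1

/-- If an active child of rank 0 vanishes, an older sibling or a missing child becomes active in its
stead, and that has rank at least -1. -/
theorem activeSum_replace {c : ℕ} {seg : List ℕ} (h : Replaces c seg) (l₁ l₂ : List ℕ) :
    activeSum (l₁ ++ c :: l₂) ≤ activeSum (l₁ ++ (seg ++ l₂)) + 1 := by
  rcases h with ⟨rfl, rfl⟩ | ⟨c', rfl, h⟩
  · rcases l₁ with _ | ⟨a, _ | ⟨b, l⟩⟩ <;> rcases l₂ with _ | ⟨d, _ | ⟨e, l'⟩⟩ <;>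
      simp [activeSum] <;> omega
  · rcases l₁ with _ | ⟨a, _ | ⟨b, l⟩⟩ <;> rcases l₂ with _ | ⟨d, l'⟩ <;>
      simp [activeSum] <;> omega

theorem activeSum_append_of_two_le {l₁ : List ℕ} (h : 2 ≤ l₁.length) (l₂ : List ℕ) :
    activeSum (l₁ ++ l₂) = activeSum l₁ := by
  rcases l₁ with _ | ⟨a, _ | ⟨b, l⟩⟩ <;> simp [activeSum] at h ⊢

/-! ### The potential of a node -/

/-- The total amount by which the ranks in the list stay below `n, n - 1, n - 2, …`. -/
def deficit : ℕ → List ℕ → ℕ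
  | _, [] => 0
  | n, c :: cs => (n - c) + deficit (n - 1) cs

theorem deficit_mono {m n : ℕ} (h : m ≤ n) (l : List ℕ) : deficit m l ≤ deficit n l := by
  induction l generalizing m n with
  | nil => simp [deficit]
  | cons c cs ih =>
    have := ih (m := m - 1) (n := n - 1) (by omega)
    simp only [deficit]
    omega

/-- Only the first `n` entries have a positive threshold, and each of them contributes at most one
more. -/
theorem deficit_le_pred_add (n : ℕ) (l : List ℕ) : deficit n l ≤ deficit (n - 1) l + n := by
  induction l generalizing n with
  | nil => simp [deficit]
  | cons c cs ih =>
    have := ih (n - 1)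
    simp only [deficit]
    rcases n with _ | n
    · simp
    · omega

/-- If a child of rank 0 vanishes, every older sibling meets a threshold higher by one. The deficit
of the vanished child, its whole threshold, covers this. -/
theorem deficit_replace {c : ℕ} {seg : List ℕ} (h : Replaces c seg) (n : ℕ) (l₁ l₂ : List ℕ) :
    deficit n (l₁ ++ (seg ++ l₂)) ≤ deficit n (l₁ ++ c :: l₂) + 1 := by
  induction l₁ generalizing n with
  | nil =>
    rcases h with ⟨rfl, rfl⟩ | ⟨c', rfl, h⟩
    · have := deficit_le_pred_add n l₂
      simp only [deficit, List.nil_append]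
      omega
    · simp only [deficit, List.nil_append, List.cons_append]
      omega
  | cons d l ih =>
    have := ih (n - 1)
    simp only [deficit, List.cons_append]
    omega

/-- The number of children beyond `2 * N`, together with the deficit of their ranks with respect
to `N - 1, N - 2, …`, with suitable weights. -/
def surplusAt (N : ℕ) (l : List ℕ) : ℕ := 4 * (l.length - 2 * N) + 8 * deficit (N - 1) l

/-- The part of the potential of a node of rank `r` that pays for its superfluous children. -/
noncomputable def surplus (r : ℕ) (l : List ℕ) : ℕ := sInf {s | ∃ N ≤ r, s = surplusAt N l}

theorem surplus_le {N r : ℕ} (h : N ≤ r) (l : List ℕ) : surplus r l ≤ surplusAt N l :=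
  Nat.sInf_le ⟨N, h, rfl⟩

/-- The choice `N = 0` makes the set nonempty, so the infimum is attained and is not the default
value. -/
theorem exists_surplus_eq (r : ℕ) (l : List ℕ) : ∃ N ≤ r, surplus r l = surplusAt N l :=
  Nat.sInf_mem (s := {s | ∃ N ≤ r, s = surplusAt N l}) ⟨_, 0, Nat.zero_le r, rfl⟩

theorem surplus_nil (r : ℕ) : surplus r [] = 0 := by
  have := surplus_le (Nat.zero_le r) []
  simpa [surplusAt, deficit] using this

/-- Used in delete-min, where each child of the removed root needs 4 units: one step, and 3 units as
a new root. -/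
theorem length_le_surplus (r : ℕ) (l : List ℕ) : 4 * l.length ≤ surplus r l + 8 * r := by
  obtain ⟨N, hN, h⟩ := exists_surplus_eq r l
  rw [h, surplusAt]
  omega

/-- With `N + 1` in place of `N` the excess length is unchanged, the two new children have no
deficit because `N ≤ r`, and the thresholds of the others go down by one. -/
theorem surplus_link (r : ℕ) (l : List ℕ) : surplus (r + 1) (r :: r :: l) ≤ surplus r l := by
  obtain ⟨N, hN, h⟩ := exists_surplus_eq r l
  have h1 := surplus_le (Nat.succ_le_succ hN) (r :: r :: l)
  have h2 := deficit_mono (show N - 2 ≤ N - 1 by omega) l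
  rw [h]
  refine h1.trans ?_
  simp only [surplusAt, deficit, List.length_cons, Nat.succ_eq_add_one, Nat.add_sub_cancel,
    Nat.sub_sub, Nat.reduceAdd] at h2 ⊢
  omega

/-- The thresholds fall by one per child although a join brings two children. This slack makes the
swap harmless: `a` moves from threshold `N - 1` to `N - 3`, and `b` stays at `N - 2`. -/
theorem surplus_link_swap (r a b : ℕ) (l : List ℕ) :
    surplus (r + 1) (r :: r :: b :: a :: l) ≤ surplus r (a :: b :: l) := by
  obtain ⟨N, hN, h⟩ := exists_surplus_eq r (a :: b :: l)
  have h1 := surplus_le (Nat.succ_le_succ hN) (r :: r :: b :: a :: l)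
  have h2 := deficit_mono (show N - 4 ≤ N - 3 by omega) l
  rw [h]
  refine h1.trans ?_
  simp only [surplusAt, deficit, List.length_cons, Nat.succ_eq_add_one, Nat.add_sub_cancel,
    Nat.sub_sub, Nat.reduceAdd] at h2 ⊢
  omega

theorem surplus_replace {c : ℕ} {seg : List ℕ} (h : Replaces c seg) (r : ℕ) (l₁ l₂ : List ℕ) :
    surplus r (l₁ ++ (seg ++ l₂)) ≤ surplus r (l₁ ++ c :: l₂) + 8 := by
  obtain ⟨N, hN, hs⟩ := exists_surplus_eq r (l₁ ++ c :: l₂)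
  have h1 := surplus_le hN (l₁ ++ (seg ++ l₂))
  have h2 := deficit_replace h (N - 1) l₁ l₂
  have h3 : seg.length ≤ 1 := by
    rcases h with ⟨rfl, -⟩ | ⟨c', rfl, -⟩ <;> simp
  rw [hs]
  refine h1.trans ?_
  simp only [surplusAt, List.length_append, List.length_cons]
  omega

/-- The minimizing `N` has to be lowered by at most one, which makes at most two more children
superfluous. -/
theorem surplus_le_succ_add (r : ℕ) (l : List ℕ) : surplus r l ≤ surplus (r + 1) l + 8 := by
  obtain ⟨N, hN, h⟩ := exists_surplus_eq (r + 1) l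
  have h1 := surplus_le (show min N r ≤ r by omega) l
  have h2 := deficit_mono (show min N r - 1 ≤ N - 1 by omega) l
  rw [h]
  refine h1.trans ?_
  simp only [surplusAt]
  omega

theorem deficit_unlink {l rest : List ℕ}
    (h : (∃ a, l = a :: rest) ∨ ∃ a b t, l = a :: b :: t ∧ rest = a :: t) (n : ℕ) :
    deficit (n - 1) rest ≤ deficit n l := by
  rcases h with ⟨a, rfl⟩ | ⟨a, b, t, rfl, rfl⟩
  · simp [deficit]
  · simp only [deficit]
    omega

/-- Detaching one of the two active children and recalculating the rank increases the surplus by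
a bounded amount. -/
theorem surplus_unlink {l rest : List ℕ}
    (h : (∃ a, l = a :: rest) ∨ ∃ a b t, l = a :: b :: t ∧ rest = a :: t) (r r' : ℕ)
    (hr : activeSum rest + 2 ≤ 2 * (r' : ℤ)) (hr' : 2 * (r' : ℤ) ≤ activeSum rest + 3) :
    surplus r' rest ≤ surplus r l + 12 := by
  obtain ⟨N, hN, hs⟩ := exists_surplus_eq r l
  have hlen : l.length = rest.length + 1 := by
    rcases h with ⟨a, rfl⟩ | ⟨a, b, t, rfl, rfl⟩ <;> simp
  have hdef := deficit_unlink h (N - 1)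
  rw [hs, surplusAt, hlen]
  -- If the new rank admits `N - 1`, this choice loses little. Otherwise the new active ranks sum to
  -- at most `2r' - 2`, far below what `N` demands: the old deficit grows with `N - r'` and offsets
  -- the `2(N - r')` children that become superfluous for the choice `r'`. With at most one child
  -- left, the surplus is at most 4.
  rcases le_or_gt (N - 1) r' with hNr | hNr
  · refine (surplus_le hNr rest).trans ?_
    simp only [surplusAt]
    omega
  · rcases rest with _ | ⟨a, _ | ⟨b, t⟩⟩
    · simp [surplus_nil]
    · refine (surplus_le (Nat.zero_le r') _).trans ?_
      simp [surplusAt, deficit]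
    · refine (surplus_le le_rfl _).trans ?_
      have h2 := deficit_mono (show r' - 3 ≤ N - 4 by omega) t
      simp only [surplusAt, deficit, activeSum, Nat.sub_sub, List.length_cons,
        Nat.reduceAdd] at *
      omega

section Trees

variable {K : Type u}

/-! ### Trees and their potential -/

theorem VTree.induct {P : VTree K → Prop}
    (h : ∀ e k r cs, (∀ c ∈ cs, P c) → P (VTree.node e k r cs)) (t : VTree K) : P t :=
  VTree.rec (motive_1 := P) (motive_2 := fun cs => ∀ c ∈ cs, P c) h (by simp)
    (fun _ _ h1 h2 => by simpa using ⟨h1, h2⟩) t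

@[simp] theorem VTree.elt_node (e : ℕ) (k : K) (r : ℕ) (cs : List (VTree K)) :
    (VTree.node e k r cs).elt = e := rfl

@[simp] theorem VTree.key_node (e : ℕ) (k : K) (r : ℕ) (cs : List (VTree K)) :
    (VTree.node e k r cs).key = k := rfl

@[simp] theorem VTree.rank_node (e : ℕ) (k : K) (r : ℕ) (cs : List (VTree K)) :
    (VTree.node e k r cs).rank = r := rfl

@[simp] theorem VTree.children_node (e : ℕ) (k : K) (r : ℕ) (cs : List (VTree K)) :
    (VTree.node e k r cs).children = cs := rfl

/-- The potential of a single node, given its rank and the ranks of its children. -/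
noncomputable def nodePotential (r : ℕ) (l : List ℕ) : ℕ :=
  surplus r l + if 2 * (r : ℤ) = activeSum l + 3 then 17 else 0

/-- The potential of a tree: the sum of the potentials of its nodes. -/
noncomputable def potential : VTree K → ℕ
  | VTree.node _ _ r cs => nodePotential r (cs.map VTree.rank) + (cs.map potential).sum

theorem potential_node (e : ℕ) (k : K) (r : ℕ) (cs : List (VTree K)) :
    potential (VTree.node e k r cs) =
      nodePotential r (cs.map VTree.rank) + (cs.map potential).sum := by
  rw [potential]

theorem surplus_le_nodePotential (r : ℕ) (l : List ℕ) : surplus r l ≤ nodePotential r l :=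
  Nat.le_add_right _ _

theorem nodePotential_le (r : ℕ) (l : List ℕ) : nodePotential r l ≤ surplus r l + 17 := by
  unfold nodePotential
  split_ifs <;> omega

theorem nodePotential_replace {c : ℕ} {seg : List ℕ} (h : Replaces c seg) (r : ℕ)
    (l₁ l₂ : List ℕ) :
    nodePotential r (l₁ ++ (seg ++ l₂)) ≤ nodePotential r (l₁ ++ c :: l₂) + 25 := by
  have h1 := surplus_replace h r l₁ l₂
  have h2 := nodePotential_le r (l₁ ++ (seg ++ l₂))
  have h3 := surplus_le_nodePotential r (l₁ ++ c :: l₂)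
  omega

/-- If the replacement of a child makes the recalculated rank smaller than the stored one, then
the update of the rank releases potential. -/
theorem nodePotential_update {c : ℕ} {seg : List ℕ} (h : Replaces c seg) {r r' : ℕ}
    {l₁ l₂ : List ℕ} (hr : 2 * (r : ℤ) ≤ activeSum (l₁ ++ c :: l₂) + 3) (hlt : r' < r)
    (h1 : activeSum (l₁ ++ (seg ++ l₂)) + 2 ≤ 2 * (r' : ℤ)) :
    nodePotential r' (l₁ ++ (seg ++ l₂)) + 1 ≤ nodePotential r (l₁ ++ c :: l₂) ∧
      r = r' + 1 := by
  have hs := activeSum_replace h l₁ l₂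
  -- With `s` and `s'` the old and new sums, `2r ≤ s + 3 ≤ s' + 4 ≤ 2r' + 2 ≤ 2r`, so equality holds
  -- throughout.
  have hr1 : r = r' + 1 := by omega
  subst hr1
  have h2 := surplus_replace h (r' + 1) l₁ l₂
  have h3 := surplus_le_succ_add r' (l₁ ++ (seg ++ l₂))
  refine ⟨?_, rfl⟩
  unfold nodePotential
  -- The equalities give `2r = s + 3` before and `2r' = s' + 2` after the update. Of the 17 units
  -- released, 8 pay for the replaced child, 8 for the lower rank, and one is left over.
  rw [if_neg (by omega), if_pos (by push_cast at *; omega)]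
  omega

theorem nodePotential_link (r : ℕ) {l l' : List ℕ}
    (h : l' = l ∨ ∃ a b t, l = a :: b :: t ∧ l' = b :: a :: t) :
    nodePotential (r + 1) (r :: r :: l') ≤ nodePotential r l := by
  refine le_trans ?_ (surplus_le_nodePotential r l)
  unfold nodePotential
  -- After a join twice the rank is `2r + 2`, one less than `s + 3` with `s = 2r`, so the 17 units
  -- are not needed.
  rw [if_neg (by simp only [activeSum]; push_cast; omega), Nat.add_zero]
  rcases h with rfl | ⟨a, b, t, rfl, rfl⟩
  · exact surplus_link r l'
  · exact surplus_link_swap r a b t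

theorem nodePotential_unlink {l rest : List ℕ}
    (h : (∃ a, l = a :: rest) ∨ ∃ a b t, l = a :: b :: t ∧ rest = a :: t) (r r' : ℕ)
    (hr : activeSum rest + 2 ≤ 2 * (r' : ℤ)) (hr' : 2 * (r' : ℤ) ≤ activeSum rest + 3) :
    nodePotential r' rest ≤ nodePotential r l + 29 := by
  have h1 := surplus_unlink h r r' hr hr'
  have h2 := nodePotential_le r' rest
  have h3 := surplus_le_nodePotential r l
  omega

/-- The potential of a heap. -/
noncomputable def heapPotential (h : Heap K) : ℕ := 3 * h.length + (h.map potential).sum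

theorem heapPotential_perm {h₁ h₂ : Heap K} (h : h₁.Perm h₂) :
    heapPotential h₁ = heapPotential h₂ := by
  rw [heapPotential, heapPotential, h.length_eq, (h.map potential).sum_eq]

theorem heapPotential_append (h₁ h₂ : Heap K) :
    heapPotential (h₁ ++ h₂) = heapPotential h₁ + heapPotential h₂ := by
  simp [heapPotential]
  ring

theorem heapPotential_cons (t : VTree K) (h : Heap K) :
    heapPotential (t :: h) = potential t + 3 + heapPotential h := by
  simp [heapPotential]
  ring

theorem heapPotential_nil : heapPotential ([] : Heap K) = 0 := rfl

/-! ### Contents -/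

theorem VTree.nodes_node (e : ℕ) (k : K) (r : ℕ) (cs : List (VTree K)) :
    (VTree.node e k r cs).nodes = (e, k) :: cs.flatMap VTree.nodes := by
  rw [VTree.nodes]

@[simp] theorem contents_nil : contents ([] : Heap K) = 0 := rfl

theorem contents_append (h₁ h₂ : Heap K) :
    contents (h₁ ++ h₂) = contents h₁ + contents h₂ := by
  simp [contents]

theorem contents_cons (t : VTree K) (h : Heap K) :
    contents (t :: h) = contents [t] + contents h := contents_append [t] h

theorem contents_node (e : ℕ) (k : K) (r : ℕ) (cs : List (VTree K)) :
    contents [VTree.node e k r cs] = (e, k) ::ₘ contents cs := by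
  simp [contents, VTree.nodes_node]

theorem contents_perm {h₁ h₂ : Heap K} (h : h₁.Perm h₂) : contents h₁ = contents h₂ :=
  Multiset.coe_eq_coe.2 (h.flatMap_right _)

theorem mem_contents {h : Heap K} {p : ℕ × K} :
    p ∈ contents h ↔ ∃ t ∈ h, p ∈ contents [t] := by
  simp [contents]

theorem contents_rank (e : ℕ) (k : K) (r r' : ℕ) (cs : List (VTree K)) :
    contents [VTree.node e k r cs] = contents [VTree.node e k r' cs] := by
  rw [contents_node, contents_node]

/-! ### Well-formed trees -/

/-- The tree is heap-ordered, and no rank is larger than the recalculated one. -/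
inductive Valid [LE K] : VTree K → Prop
  | node (e : ℕ) (k : K) (r : ℕ) (cs : List (VTree K)) :
      2 * (r : ℤ) ≤ activeSum (cs.map VTree.rank) + 3 → (∀ c ∈ cs, k ≤ c.key) →
      (∀ c ∈ cs, Valid c) → Valid (VTree.node e k r cs)

theorem valid_node [LE K] {e : ℕ} {k : K} {r : ℕ} {cs : List (VTree K)} :
    Valid (VTree.node e k r cs) ↔ 2 * (r : ℤ) ≤ activeSum (cs.map VTree.rank) + 3 ∧
      (∀ c ∈ cs, k ≤ c.key) ∧ ∀ c ∈ cs, Valid c :=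
  ⟨fun h => by cases h; exact ⟨‹_›, ‹_›, ‹_›⟩, fun h => .node e k r cs h.1 h.2.1 h.2.2⟩

theorem Valid.key_le [Preorder K] {t : VTree K} (h : Valid t) :
    ∀ p ∈ contents [t], t.key ≤ p.2 := by
  induction h with
  | node e k r cs _ hk _ ih =>
    intro p hp
    rw [contents_node, Multiset.mem_cons] at hp
    rcases hp with rfl | hp
    · exact le_rfl
    · obtain ⟨c, hc, hp⟩ := mem_contents.1 hp
      exact (hk c hc).trans (ih c hc p hp)

/-! ### Sizes of trees and the bound on ranks -/

theorem size_cons (t : VTree K) (h : Heap K) : size (t :: h) = size [t] + size h := by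
  rw [size, contents_cons, Multiset.card_add]; rfl

theorem size_append (h₁ h₂ : Heap K) : size (h₁ ++ h₂) = size h₁ + size h₂ := by
  rw [size, contents_append, Multiset.card_add]; rfl

theorem size_singleton_le {t : VTree K} {h : Heap K} (ht : t ∈ h) : size [t] ≤ size h := by
  obtain ⟨l₁, l₂, rfl⟩ := List.append_of_mem ht
  rw [size_append, size_cons t l₂]
  omega

theorem size_node (e : ℕ) (k : K) (r : ℕ) (cs : List (VTree K)) :
    size [VTree.node e k r cs] = size cs + 1 := by
  rw [size, contents_node, Multiset.card_cons]; rfl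

/-- The size of a tree is exponential in its rank. -/
theorem Valid.pow_rank_le [LE K] {t : VTree K} (h : Valid t) :
    (3 / 2 : ℝ) ^ (t.rank + 1) ≤ size [t] + 1 := by
  -- Here `p` and `q` are the ranks of the active children plus one, and `x` and `y` their sizes
  -- plus one, so a missing child is `p = 0`, `x = 1`. The base 3/2 works because `(3/2)^3 = 27/8 ≤
  -- 4` and `(u + v)^2 ≥ 4uv`.
  have key : ∀ (r p q : ℕ) (x y : ℝ), 2 * r ≤ p + q + 1 → (3 / 2 : ℝ) ^ p ≤ x →
      (3 / 2 : ℝ) ^ q ≤ y → (3 / 2 : ℝ) ^ (r + 1) ≤ x + y := by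
    intro r p q x y hpq hx hy
    have hp : (0 : ℝ) < (3 / 2) ^ p := by positivity
    have hq : (0 : ℝ) < (3 / 2) ^ q := by positivity
    refine le_trans ?_ (add_le_add hx hy)
    refine abs_le_of_sq_le_sq' ?_ (by positivity) |>.2
    have h1 : ((3 / 2 : ℝ) ^ (r + 1)) ^ 2 ≤ (3 / 2) ^ (p + q + 3) := by
      rw [← pow_mul]
      exact pow_le_pow_right₀ (by norm_num) (by omega)
    have h2 : (3 / 2 : ℝ) ^ (p + q + 3) = (3 / 2) ^ p * (3 / 2) ^ q * (27 / 8) := by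
      rw [pow_add, pow_add]; norm_num
    nlinarith [sq_nonneg ((3 / 2 : ℝ) ^ p - (3 / 2) ^ q), mul_pos hp hq]
  induction h with
  | node e k r cs hr _ _ ih =>
    rw [size_node]
    simp only [VTree.rank_node]
    rcases cs with _ | ⟨a, _ | ⟨b, l⟩⟩
    · refine (key r 0 0 1 1 (by simp [activeSum] at hr; omega) (by simp) (by simp)).trans ?_
      simp [size]
    · have ha := ih a (by simp)
      refine (key r (a.rank + 1) 0 _ 1 (by simp [activeSum] at hr; omega) ha (by simp)).trans ?_
      push_cast
      linarith
    · have ha := ih a (by simp)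
      have hb := ih b (by simp)
      refine (key r (a.rank + 1) (b.rank + 1) _ _ (by simp [activeSum] at hr; omega) ha
        hb).trans ?_
      rw [size_cons a (b :: l), size_cons b l]
      push_cast
      have : (0 : ℝ) ≤ size l := by positivity
      linarith

/-! ### Joins -/

theorem Arranged.perm {cs cs' : List (VTree K)} (h : Arranged cs cs') : cs'.Perm cs := by
  cases h with
  | few => exact .refl _
  | keep => exact .refl _
  | swap a b l => exact .swap a b l

theorem Arranged.ranks {cs cs' : List (VTree K)} (h : Arranged cs cs') :
    cs'.map VTree.rank = cs.map VTree.rank ∨ ∃ a b t, cs.map VTree.rank = a :: b :: t ∧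
      cs'.map VTree.rank = b :: a :: t := by
  cases h with
  | few => exact .inl rfl
  | keep => exact .inl rfl
  | swap a b l => exact .inr ⟨_, _, _, rfl, rfl⟩

theorem exists_arranged (cs : List (VTree K)) : ∃ cs', Arranged cs cs' := by
  rcases cs with _ | ⟨a, _ | ⟨b, l⟩⟩
  · exact ⟨_, .few _ (by simp)⟩
  · exact ⟨_, .few _ (by simp)⟩
  · rcases le_total b.rank a.rank with h | h
    · exact ⟨_, .keep a b l h⟩
    · exact ⟨_, .swap a b l h⟩

theorem Join.contents_eq [LE K] {a b c w : VTree K} (h : Join a b c w) :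
    contents [w] = contents [a, b, c] := by
  obtain ⟨z, z₁, z₂, cs, hp, -, -, -, -, har⟩ := h
  obtain ⟨e, k, r, ds⟩ := z
  rw [contents_perm hp, contents_node, contents_cons (VTree.node e k r ds), contents_node,
    contents_cons z₁ (z₂ :: cs), contents_cons z₂ cs, contents_cons z₁ [z₂],
    contents_perm har.perm]
  simp only [VTree.elt_node, VTree.key_node, VTree.children_node, ← Multiset.singleton_add]
  abel

theorem Join.valid [Preorder K] {a b c w : VTree K} (h : Join a b c w)
    (hv : ∀ t ∈ [a, b, c], Valid t) : Valid w := by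
  obtain ⟨z, z₁, z₂, cs, hp, h1, h2, hk1, hk2, har⟩ := h
  obtain ⟨e, k, r, ds⟩ := z
  have hv' : ∀ t ∈ [VTree.node e k r ds, z₁, z₂], Valid t := fun t ht => hv t (hp.mem_iff.2 ht)
  have hz := valid_node.1 (hv' (VTree.node e k r ds) (by simp))
  simp only [VTree.elt_node, VTree.key_node, VTree.children_node, VTree.rank_node] at *
  refine valid_node.2 ⟨?_, ?_, ?_⟩
  · simp [activeSum, h1, h2]
    omega
  · simp only [List.mem_cons]
    rintro t (rfl | rfl | ht)
    · exact hk1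
    · exact hk2
    · exact hz.2.1 t (har.perm.mem_iff.1 ht)
  · simp only [List.mem_cons]
    rintro t (rfl | rfl | ht)
    · exact hv' _ (by simp)
    · exact hv' _ (by simp)
    · exact hz.2.2 t (har.perm.mem_iff.1 ht)

theorem Join.potential_le [LE K] {a b c w : VTree K} (h : Join a b c w) :
    potential w ≤ potential a + potential b + potential c := by
  obtain ⟨z, z₁, z₂, cs, hp, h1, h2, -, -, har⟩ := h
  obtain ⟨e, k, r, ds⟩ := z
  have hs := (hp.map potential).sum_eq
  have hc := (har.perm.map potential).sum_eq
  have hl := nodePotential_link r har.ranks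
  simp only [VTree.elt_node, VTree.key_node, VTree.children_node, VTree.rank_node,
    List.map_cons, List.map_nil, List.sum_cons, List.sum_nil, potential_node] at *
  rw [h1, h2]
  omega

theorem exists_join [LinearOrder K] {a b c : VTree K} (hb : b.rank = a.rank)
    (hc : c.rank = a.rank) : ∃ w, Join a b c w := by
  have main : ∀ z z₁ z₂ : VTree K, [a, b, c].Perm [z, z₁, z₂] → z₁.rank = z.rank →
      z₂.rank = z.rank → z.key ≤ z₁.key → z.key ≤ z₂.key → ∃ w, Join a b c w := by
    intro z z₁ z₂ hp h1 h2 hk1 hk2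
    obtain ⟨cs, hcs⟩ := exists_arranged z.children
    exact ⟨_, .mk a b c z z₁ z₂ cs hp h1 h2 hk1 hk2 hcs⟩
  have p1 : [a, b, c].Perm [b, a, c] := .swap _ _ _
  have p2 : [a, b, c].Perm [c, a, b] := (List.perm_append_comm (l₁ := [a, b]) (l₂ := [c]))
  rcases le_total a.key b.key with h | h <;> rcases le_total a.key c.key with h' | h' <;>
    rcases le_total b.key c.key with h'' | h''
  · exact main a b c (.refl _) hb hc h h'
  · exact main a b c (.refl _) hb hc h h'
  · exact main c a b p2 hc.symm (hb.trans hc.symm) h' (h'.trans h)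
  · exact main c a b p2 hc.symm (hb.trans hc.symm) h' h''
  · exact main b a c p1 hb.symm (hc.trans hb.symm) h h''
  · exact main b a c p1 hb.symm (hc.trans hb.symm) h (h.trans h')
  · exact main b a c p1 hb.symm (hc.trans hb.symm) h h''
  · exact main c a b p2 hc.symm (hb.trans hc.symm) h' h''

end Trees

section Consolidation

variable {K : Type u}

/-! ### Consolidation -/

/-- `R` consists of the entries of all other cells, and does not depend on the new content `x`. -/
theorem flatten_set_perm {α : Type*} {A : List (List α)} {i : ℕ} {b : List α}
    (h : A[i]? = some b) :
    ∃ R, A.flatten.Perm (b ++ R) ∧ ∀ x, (A.set i x).flatten.Perm (x ++ R) := by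
  induction A generalizing i with
  | nil => simp at h
  | cons a A ih =>
    rcases i with _ | i
    · simp only [List.getElem?_cons_zero, Option.some.injEq] at h
      subst h
      exact ⟨A.flatten, by simp, fun x => by simp⟩
    · obtain ⟨R, h1, h2⟩ := ih (by simpa using h)
      have aux : ∀ (x t : List α), t.Perm (x ++ R) → (a ++ t).Perm (x ++ (a ++ R)) := by
        intro x t ht
        refine (ht.append_left a).trans ?_
        rw [← List.append_assoc, ← List.append_assoc]
        exact List.perm_append_comm.append_right R
      exact ⟨a ++ R, by simpa using aux _ _ h1, fun x => by simpa using aux _ _ (h2 x)⟩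

theorem length_flatten_le {α : Type*} {A : List (List α)} (hA : ∀ b ∈ A, b.length ≤ 2) :
    A.flatten.length ≤ 2 * A.length := by
  induction A with
  | nil => simp
  | cons a A ih =>
    have h1 := ih fun b hb => hA b (List.mem_cons_of_mem a hb)
    have h2 := hA a List.mem_cons_self
    simp only [List.flatten_cons, List.length_append, List.length_cons]
    omega

/-- The factor 3 comes from `log (3/2) ≥ 1 - 2/3`, the summand 1 from `n + 1 ≤ 2n` and `log 2 ≤ 1`.
-/
theorem le_three_mul_one_add_log {m n : ℕ} (hn : 0 < n) (h : (3 / 2 : ℝ) ^ m ≤ n + 1) :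
    (m : ℝ) ≤ 3 * (1 + Real.log n) := by
  have hn' : (1 : ℝ) ≤ n := by exact_mod_cast hn
  have h1 : Real.log ((3 / 2 : ℝ) ^ m) ≤ Real.log (2 * n) :=
    Real.log_le_log (by positivity) (by linarith)
  rw [Real.log_pow, Real.log_mul (by norm_num) (by positivity)] at h1
  have h2 : Real.log 2 ≤ 2 - 1 := Real.log_le_sub_one_of_pos (by norm_num)
  have h3 := Real.one_sub_inv_le_log_of_pos (show (0 : ℝ) < 3 / 2 by norm_num)
  have h4 : (m : ℝ) * (1 / 3) ≤ m * Real.log (3 / 2) :=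
    mul_le_mul_of_nonneg_left (by norm_num at h3 ⊢; linarith) (by positivity)
  linarith

/-- All trees that take part in a consolidation. -/
abbrev pool (ts : List (VTree K)) (A : List (List (VTree K))) : List (VTree K) := ts ++ A.flatten

theorem pool_grow (ts : List (VTree K)) (A : List (List (VTree K))) :
    pool ts (A ++ [[]]) = pool ts A := by
  simp [pool]

theorem pool_place {t : VTree K} {ts b : List (VTree K)} {A : List (List (VTree K))} {i : ℕ}
    (h : A[i]? = some b) : (pool ts (A.set i (t :: b))).Perm (pool (t :: ts) A) := by
  obtain ⟨R, h1, h2⟩ := flatten_set_perm h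
  refine ((h2 _).append_left ts).trans (.trans ?_ (h1.symm.append_left (t :: ts)))
  simp

theorem pool_join {t v₁ v₂ : VTree K} {ts : List (VTree K)} {A : List (List (VTree K))} {i : ℕ}
    (h : A[i]? = some [v₁, v₂]) :
    ∃ R, (pool (t :: ts) A).Perm ([t, v₁, v₂] ++ R) ∧
      ∀ w, (pool (w :: ts) (A.set i [])).Perm (w :: R) := by
  obtain ⟨R, h1, h2⟩ := flatten_set_perm h
  refine ⟨ts ++ R, (h1.append_left (t :: ts)).trans ?_, fun w => by
    simpa [pool] using ((h2 []).append_left ts)⟩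
  simp only [List.cons_append, List.perm_cons, List.nil_append]
  exact (List.perm_middle.trans (List.perm_middle.cons v₁))

variable [LinearOrder K] {ts : List (VTree K)} {A A' : List (List (VTree K))} {c : ℕ}

theorem Consolidate.contents_eq (h : Consolidate ts A A' c) :
    contents A'.flatten = contents (pool ts A) := by
  induction h with
  | done A => simp [pool]
  | grow t ts A A' c _ _ ih => rw [ih, pool_grow]
  | place t ts b A A' c hb _ _ ih => rw [ih, contents_perm (pool_place hb)]
  | join t v₁ v₂ w ts A A' c hb hj _ ih =>
    obtain ⟨R, h1, h2⟩ := pool_join (t := t) (ts := ts) hb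
    rw [ih, contents_perm h1, contents_perm (h2 w), contents_cons, hj.contents_eq,
      contents_append]

theorem Consolidate.valid (h : Consolidate ts A A' c) (hv : ∀ t ∈ pool ts A, Valid t) :
    ∀ t ∈ A'.flatten, Valid t := by
  induction h with
  | done A => simpa [pool] using hv
  | grow t ts A A' c _ _ ih => exact ih (by rwa [pool_grow])
  | place t ts b A A' c hb _ _ ih => exact ih fun s hs => hv s ((pool_place hb).mem_iff.1 hs)
  | join t v₁ v₂ w ts A A' c hb hj _ ih =>
    obtain ⟨R, h1, h2⟩ := pool_join (t := t) (ts := ts) hb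
    have hv' : ∀ s ∈ [t, v₁, v₂] ++ R, Valid s := fun s hs => hv s (h1.mem_iff.2 hs)
    refine ih fun s hs => ?_
    rcases List.mem_cons.1 ((h2 w).mem_iff.1 hs) with rfl | hs
    · exact hj.valid fun s hs => hv' s (List.mem_append_left R hs)
    · exact hv' s (List.mem_append_right _ hs)

theorem Consolidate.potential_le (h : Consolidate ts A A' c) :
    (A'.flatten.map potential).sum ≤ ((pool ts A).map potential).sum := by
  induction h with
  | done A => simp [pool]
  | grow t ts A A' c _ _ ih => rwa [pool_grow] at ih
  | place t ts b A A' c hb _ _ ih => rwa [((pool_place hb).map potential).sum_eq] at ih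
  | join t v₁ v₂ w ts A A' c hb hj _ ih =>
    obtain ⟨R, h1, h2⟩ := pool_join (t := t) (ts := ts) hb
    have h3 := hj.potential_le
    rw [((h2 w).map potential).sum_eq] at ih
    rw [(h1.map potential).sum_eq]
    simp only [List.cons_append, List.nil_append, List.map_cons, List.sum_cons] at ih ⊢
    omega

/-- A waiting tree holds 3 units and a stored tree 2. Storing a tree frees one unit; a join turns 3
+ 2 + 2 units into the 3 of one waiting tree. Growth of the array is charged to its final length. -/
theorem Consolidate.cost_le (h : Consolidate ts A A' c) :
    c + A.length + 2 * A'.flatten.length ≤ A'.length + 3 * ts.length + 2 * A.flatten.length := by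
  induction h with
  | done A => simp
  | grow t ts A A' c _ _ ih =>
    simp only [List.length_append, List.flatten_append, List.length_cons, List.length_nil,
      List.flatten_cons, List.flatten_nil, List.nil_append] at *
    omega
  | place t ts b A A' c hb _ _ ih =>
    obtain ⟨R, h1, h2⟩ := flatten_set_perm hb
    rw [(h2 (t :: b)).length_eq] at ih
    rw [h1.length_eq]
    simp only [List.length_set, List.length_append, List.length_cons] at *
    omega
  | join t v₁ v₂ w ts A A' c hb hj _ ih =>
    obtain ⟨R, h1, h2⟩ := flatten_set_perm hb
    rw [(h2 []).length_eq] at ih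
    rw [h1.length_eq]
    simp only [List.length_set, List.length_append, List.length_cons, List.length_nil] at *
    omega

theorem Consolidate.cell_length_le (h : Consolidate ts A A' c) (hA : ∀ b ∈ A, b.length ≤ 2) :
    ∀ b ∈ A', b.length ≤ 2 := by
  induction h with
  | done A => exact hA
  | grow t ts A A' c _ _ ih =>
    refine ih fun b hb => ?_
    rcases List.mem_append.1 hb with hb | hb
    · exact hA b hb
    · simp_all
  | place t ts b A A' c _ hl _ ih =>
    refine ih fun b' hb' => ?_
    rcases List.mem_or_eq_of_mem_set hb' with hb' | rfl
    · exact hA b' hb'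
    · simpa using Nat.succ_le_of_lt hl
  | join t v₁ v₂ w ts A A' c _ _ _ ih =>
    refine ih fun b' hb' => ?_
    rcases List.mem_or_eq_of_mem_set hb' with hb' | rfl
    · exact hA b' hb'
    · simp

/-- The array never becomes longer than the ranks of trees permit. -/
theorem Consolidate.pow_length_le (h : Consolidate ts A A' c) (hv : ∀ t ∈ pool ts A, Valid t)
    (hA : (3 / 2 : ℝ) ^ A.length ≤ size (pool ts A) + 1) :
    (3 / 2 : ℝ) ^ A'.length ≤ size (pool ts A) + 1 := by
  induction h with
  | done A => exact hA
  | grow t ts A A' c hl _ ih =>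
    rw [pool_grow] at ih
    refine ih hv ?_
    -- A cell is appended only on behalf of a tree whose rank is at least the current length, so the
    -- new length is at most that rank plus one.
    have h1 := (hv t (by simp)).pow_rank_le
    have h2 : (size [t] : ℝ) ≤ size (pool (t :: ts) A) := by
      exact_mod_cast size_singleton_le (by simp)
    have h3 : (3 / 2 : ℝ) ^ (A ++ [[]]).length ≤ (3 / 2) ^ (t.rank + 1) :=
      pow_le_pow_right₀ (by norm_num) (by simpa using hl)
    linarith
  | place t ts b A A' c hb _ _ ih =>
    have hs : size (pool ts (A.set t.rank (t :: b))) = size (pool (t :: ts) A) := by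
      rw [size, contents_perm (pool_place hb)]; rfl
    rw [hs, List.length_set] at ih
    exact ih (fun s hs => hv s ((pool_place hb).mem_iff.1 hs)) hA
  | join t v₁ v₂ w ts A A' c hb hj _ ih =>
    obtain ⟨R, h1, h2⟩ := pool_join (t := t) (ts := ts) hb
    have hv' : ∀ s ∈ [t, v₁, v₂] ++ R, Valid s := fun s hs => hv s (h1.mem_iff.2 hs)
    have hs : size (pool (w :: ts) (A.set t.rank [])) = size (pool (t :: ts) A) := by
      rw [size, size, contents_perm (h2 w), contents_perm h1, contents_cons, hj.contents_eq,
        contents_append]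
    rw [hs, List.length_set] at ih
    refine ih (fun s hs => ?_) hA
    rcases List.mem_cons.1 ((h2 w).mem_iff.1 hs) with rfl | hs
    · exact hj.valid fun s hs => hv' s (List.mem_append_left R hs)
    · exact hv' s (List.mem_append_right _ hs)

/-- The consolidation can always be carried out. -/
theorem exists_consolidate (ts : List (VTree K)) (A : List (List (VTree K)))
    (hA : ∀ (i : ℕ) (b : List (VTree K)), A[i]? = some b → b.length ≤ 2 ∧ ∀ t ∈ b, t.rank = i) :
    ∃ A' c, Consolidate ts A A' c := by
  -- This measure drops when a tree is stored or joined. Growing the array leaves it unchanged,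
  -- hence the inner induction on the number of missing cells.
  obtain ⟨n, hn⟩ : ∃ n, n = 3 * ts.length + 2 * A.flatten.length := ⟨_, rfl⟩
  induction n using Nat.strong_induction_on generalizing ts A with
  | _ n ih =>
    rcases ts with _ | ⟨t, ts⟩
    · exact ⟨A, 0, .done A⟩
    obtain ⟨d, hd⟩ : ∃ d, d = t.rank + 1 - A.length := ⟨_, rfl⟩
    induction d generalizing A with
    | zero =>
      obtain ⟨b, hb⟩ : ∃ b, A[t.rank]? = some b :=
        ⟨_, List.getElem?_eq_getElem (show t.rank < A.length by omega)⟩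
      obtain ⟨R, h1, h2⟩ := flatten_set_perm hb
      have l1 := h1.length_eq
      obtain ⟨hb2, hbr⟩ := hA _ _ hb
      have hset : ∀ x : List (VTree K), x.length ≤ 2 → (∀ s ∈ x, s.rank = t.rank) →
          ∀ (i : ℕ) (b : List (VTree K)), (A.set t.rank x)[i]? = some b →
            b.length ≤ 2 ∧ ∀ s ∈ b, s.rank = i := by
        intro x hx hxr i b hi
        rw [List.getElem?_set] at hi
        split_ifs at hi with h3 h4
        · obtain rfl : x = b := by simpa using hi
          subst h3
          exact ⟨hx, hxr⟩
        · exact hA i b hi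
      rcases lt_or_eq_of_le hb2 with hlt | heq
      · have l2 := (h2 (t :: b)).length_eq
        obtain ⟨A', c, h⟩ := ih _ (by
            simp only [List.length_cons, List.length_append] at hn l1 l2 ⊢; omega) ts
          (A.set t.rank (t :: b)) (hset _ (by simpa using hlt) (by simpa using hbr)) rfl
        exact ⟨A', c + 1, .place t ts b A A' c hb hlt h⟩
      · obtain ⟨v₁, v₂, rfl⟩ := List.length_eq_two.1 heq
        obtain ⟨w, hw⟩ := exists_join (hbr v₁ (by simp)) (hbr v₂ (by simp))
        have l2 := (h2 []).length_eq
        obtain ⟨A', c, h⟩ := ih _ (by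
            simp only [List.length_cons, List.length_append, List.length_nil] at hn l1 l2 ⊢
            omega) (w :: ts) (A.set t.rank []) (hset _ (by simp) (by simp)) rfl
        exact ⟨A', c + 1, .join t v₁ v₂ w ts A A' c hb hw h⟩
    | succ d ihd =>
      obtain ⟨A', c, h⟩ := ihd (A ++ [[]]) (by
        intro i b hi
        rw [List.getElem?_append] at hi
        split_ifs at hi with h1
        · exact hA i b hi
        · have : b = [] := by
            have := List.mem_of_getElem? hi
            simpa using this
          simp [this]) (by simpa using hn) (by simp; omega)
      exact ⟨A', c + 1, .grow t ts A A' c (by omega) h⟩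

/-! ### Heaps -/

/-- The trees of the heap are well-formed, and its first root has minimum key. -/
def HeapValid (h : Heap K) : Prop :=
  (∀ t ∈ h, Valid t) ∧ ∀ m ∈ h.head?, ∀ t ∈ h, m.key ≤ t.key

theorem HeapValid.key_le {t : VTree K} {h : Heap K} (hv : HeapValid (t :: h)) :
    ∀ p ∈ contents (t :: h), t.key ≤ p.2 := by
  intro p hp
  obtain ⟨s, hs, hp⟩ := mem_contents.1 hp
  exact (hv.2 t rfl s hs).trans ((hv.1 s hs).key_le p hp)

/-! ### Delete-min -/

theorem DeleteMin.exists (z : VTree K) (hs : Heap K) :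
    ∃ c h', DeleteMin (z :: hs) z c h' := by
  obtain ⟨A, c, h⟩ := exists_consolidate (z.children ++ hs) [] (by simp)
  obtain ⟨h', hp, hm⟩ : ∃ h' : Heap K, h'.Perm A.flatten ∧
      ∀ m ∈ h'.head?, ∀ t ∈ h', m.key ≤ t.key := by
    rcases hA : A.flatten with _ | ⟨a, l⟩
    · exact ⟨[], .refl _, by simp⟩
    · obtain ⟨m, hm, hmin⟩ := Set.exists_min_image {t | t ∈ a :: l} VTree.key
        (List.finite_toSet _) ⟨a, List.mem_cons_self⟩
      obtain ⟨l₁, l₂, hl⟩ := List.append_of_mem (show m ∈ a :: l from hm)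
      have hperm : (m :: (l₁ ++ l₂)).Perm (a :: l) := hl ▸ List.perm_middle.symm
      refine ⟨_, hperm, ?_⟩
      rintro _ ⟨⟩ t ht
      exact hmin t (hperm.mem_iff.1 ht)
  exact ⟨_, h', .mk z hs _ A c h' (.refl _) h hp hm⟩

variable {h h' : Heap K} {z : VTree K}

theorem DeleteMin.contents_eq (hd : DeleteMin h z c h') :
    contents h = (z.elt, z.key) ::ₘ contents h' := by
  obtain ⟨z, hs, ts, A, c, h', hp, hc, hp', -⟩ := hd
  rw [contents_perm hp', hc.contents_eq, pool, List.flatten_nil, List.append_nil,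
    contents_perm hp, contents_append, contents_cons]
  obtain ⟨e, k, r, cs⟩ := z
  rw [contents_node, Multiset.cons_add]
  rfl

theorem DeleteMin.valid (hd : DeleteMin h z c h') (hv : HeapValid h) : HeapValid h' := by
  obtain ⟨z, hs, ts, A, c, h', hp, hc, hp', hm⟩ := hd
  refine ⟨fun t ht => hc.valid ?_ t (hp'.mem_iff.1 ht), hm⟩
  intro s hs'
  rw [pool, List.flatten_nil, List.append_nil, hp.mem_iff, List.mem_append] at hs'
  obtain ⟨e, k, r, cs⟩ := z
  rcases hs' with hs' | hs'
  · exact (valid_node.1 (hv.1 _ List.mem_cons_self)).2.2 s hs'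
  · exact hv.1 s (List.mem_cons_of_mem _ hs')

theorem DeleteMin.cost_le (hd : DeleteMin h z c h') (hv : HeapValid h) :
    (c : ℝ) + heapPotential h' ≤ heapPotential h + 100 * (1 + Real.log (size h)) := by
  have hcont := hd.contents_eq
  obtain ⟨z, hs, ts, A, c, h', hp, hc, hp', hm⟩ := hd
  have hsz : size (z :: hs) = size (pool ts []) + 1 := by
    rw [size, hcont, Multiset.card_cons, contents_perm hp', hc.contents_eq]; rfl
  have hpos : 0 < size (z :: hs) := by omega
  have hpool : ∀ t ∈ pool ts [], Valid t := by
    intro s hs'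
    rw [pool, List.flatten_nil, List.append_nil, hp.mem_iff, List.mem_append] at hs'
    obtain ⟨e, k, r, cs⟩ := z
    rcases hs' with hs' | hs'
    · exact (valid_node.1 (hv.1 _ List.mem_cons_self)).2.2 s hs'
    · exact hv.1 s (List.mem_cons_of_mem _ hs')
  have hA := hc.pow_length_le hpool (by simp)
  have hA' : (A.length : ℝ) ≤ 3 * (1 + Real.log (size (z :: hs))) :=
    le_three_mul_one_add_log hpos (hA.trans (by rw [hsz]; push_cast; linarith))
  have hr' : ((z.rank + 1 : ℕ) : ℝ) ≤ 3 * (1 + Real.log (size (z :: hs))) := by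
    refine le_three_mul_one_add_log hpos ((hv.1 z List.mem_cons_self).pow_rank_le.trans ?_)
    have : (size [z] : ℝ) ≤ size (z :: hs) := by
      exact_mod_cast size_singleton_le List.mem_cons_self
    linarith
  have hcost := hc.cost_le
  have hpot := hc.potential_le
  have hlen := length_flatten_le (hc.cell_length_le (by simp))
  -- The surplus of `z` covers 4 units per child up to `8 * z.rank`. The old roots bring their 3
  -- units for the consolidation, and at most `2 * A.length` roots remain.
  have key : 1 + z.children.length + c + A.length + h'.length + heapPotential h' ≤
      heapPotential (z :: hs) + 10 * A.length + 8 * (z.rank + 1) := by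
    rw [heapPotential_cons, heapPotential, heapPotential, hp'.length_eq,
      (hp'.map potential).sum_eq]
    rw [pool, List.flatten_nil, List.append_nil, (hp.map potential).sum_eq] at hpot
    rw [hp.length_eq] at hcost
    obtain ⟨e, k, r, cs⟩ := z
    have h1 := length_le_surplus r (cs.map VTree.rank)
    have h2 := surplus_le_nodePotential r (cs.map VTree.rank)
    simp only [VTree.children_node, VTree.rank_node, potential_node, List.map_append,
      List.sum_append, List.length_append, List.length_map, List.length_nil, List.flatten_nil] at *
    omega
  have key' : ((1 + z.children.length + c + A.length + h'.length : ℕ) : ℝ) + heapPotential h' ≤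
      heapPotential (z :: hs) + 10 * A.length + 8 * (z.rank + 1 : ℕ) := by
    exact_mod_cast key
  have hlog := Real.log_natCast_nonneg (size (z :: hs))
  linarith

end Consolidation

section Paths

variable {K : Type u}

/-! ### Positions and rank propagation -/

/-- The pairs stored outside the subtree whose position is given by the path. -/
def pathContents : List (Frame K) → Multiset (ℕ × K)
  | [] => 0
  | f :: fs => (f.elt, f.key) ::ₘ (contents f.newer + contents f.older + pathContents fs)

theorem contents_fill (f : Frame K) (seg : List (VTree K)) :
    contents [f.fill seg] = contents seg + (f.elt, f.key) ::ₘ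
      (contents f.newer + contents f.older) := by
  rw [Frame.fill, contents_node, Frame.kids, contents_append, contents_append]
  simp only [← Multiset.singleton_add]
  abel

theorem contents_plug (t : VTree K) (fs : List (Frame K)) :
    contents [plug t fs] = contents [t] + pathContents fs := by
  induction fs generalizing t with
  | nil => simp [plug, pathContents]
  | cons f fs ih =>
    rw [plug, ih, contents_fill, pathContents]
    simp only [← Multiset.singleton_add]
    abel

theorem contents_climb (seg : List (VTree K)) (fs : List (Frame K)) :
    contents (climb seg fs).1 = contents seg + pathContents fs := by
  induction fs generalizing seg with
  | nil => simp [climb, pathContents]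
  | cons f fs ih =>
    have halted : contents [plug (f.fill seg) fs] = contents seg + pathContents (f :: fs) := by
      rw [contents_plug, contents_fill, pathContents]
      simp only [← Multiset.singleton_add]
      abel
    rw [climb]
    split_ifs
    · dsimp only
      rw [ih, contents_rank _ _ _ f.rank]
      rw [contents_plug, Frame.fill] at halted
      exact halted
    · exact halted
    · exact halted

theorem exists_plug_of_mem {t : VTree K} {x : ℕ} {k : K} (h : (x, k) ∈ contents [t]) :
    ∃ r cs fs, t = plug (VTree.node x k r cs) fs := by
  have plug_append : ∀ (s : VTree K) (fs gs : List (Frame K)),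
      plug s (fs ++ gs) = plug (plug s fs) gs := by
    intro s fs gs
    induction fs generalizing s with
    | nil => rfl
    | cons f fs ih => exact ih _
  induction t using VTree.induct with
  | h e k' r cs ih =>
    rw [contents_node, Multiset.mem_cons] at h
    rcases h with h | h
    · obtain ⟨rfl, rfl⟩ := Prod.mk.inj h
      exact ⟨r, cs, [], rfl⟩
    · obtain ⟨c, hc, h⟩ := mem_contents.1 h
      obtain ⟨r', cs', fs, rfl⟩ := ih c hc h
      obtain ⟨l₁, l₂, rfl⟩ := List.append_of_mem hc
      refine ⟨r', cs', fs ++ [⟨e, k', r, l₁, l₂⟩], ?_⟩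
      rw [plug_append]
      simp [plug, Frame.fill, Frame.kids]

theorem map_rank_kids (f : Frame K) (seg : List (VTree K)) :
    (f.kids seg).map VTree.rank =
      f.newer.map VTree.rank ++ (seg.map VTree.rank ++ f.older.map VTree.rank) := by
  simp [Frame.kids]

theorem plug_key_congr {a b : VTree K} (h : a.key = b.key) (fs : List (Frame K)) :
    (plug a fs).key = (plug b fs).key := by
  induction fs generalizing a b with
  | nil => exact h
  | cons f fs ih => exact ih rfl

/-- The propagation inside a tree results in one tree with the same root key. -/
theorem climb_cons_eq (seg : List (VTree K)) (f : Frame K) (fs : List (Frame K)) (a : VTree K) :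
    ∃ t, (climb seg (f :: fs)).1 = [t] ∧ t.key = (plug a (f :: fs)).key := by
  induction fs generalizing seg f a with
  | nil =>
    rw [climb]
    split_ifs <;> exact ⟨_, rfl, rfl⟩
  | cons g gs ih =>
    rw [climb]
    split_ifs
    · exact ih _ g (f.fill [a])
    · exact ⟨_, rfl, plug_key_congr (a := f.fill seg) (b := f.fill [a]) rfl (g :: gs)⟩
    · exact ⟨_, rfl, plug_key_congr (a := f.fill seg) (b := f.fill [a]) rfl (g :: gs)⟩

/-- The potential of a node sees only the ranks of its children, so no ancestor notices the
exchange. The additive form avoids truncated subtraction. -/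
theorem potential_plug_congr {a b : VTree K} (hr : b.rank = a.rank) (fs : List (Frame K)) :
    potential (plug a fs) + potential b = potential (plug b fs) + potential a := by
  induction fs generalizing a b with
  | nil => exact Nat.add_comm _ _
  | cons f fs ih =>
    have h1 := ih (a := f.fill [a]) (b := f.fill [b]) rfl
    have h2 : potential (f.fill [a]) + potential b = potential (f.fill [b]) + potential a := by
      rw [Frame.fill, Frame.fill, potential_node, potential_node, map_rank_kids, map_rank_kids]
      simp only [Frame.kids, List.map_append, List.map_cons, List.map_nil, List.sum_append,
        List.sum_cons, List.sum_nil, hr]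
      omega
    simp only [plug]
    omega

/-! ### Detaching a child -/

theorem exists_detach (cs : List (VTree K)) : ∃ seg rest, Detach cs seg rest := by
  rcases cs with _ | ⟨a, _ | ⟨b, l⟩⟩
  · exact ⟨_, _, .none⟩
  · exact ⟨_, _, .only a⟩
  · rcases le_total b.rank a.rank with h | h
    · exact ⟨_, _, .last a b l h⟩
    · exact ⟨_, _, .second a b l h⟩

theorem Detach.perm {cs seg rest : List (VTree K)} (h : Detach cs seg rest) :
    cs.Perm (seg ++ rest) := by
  cases h with
  | none => exact .refl _
  | only a => exact .refl _
  | last a b l => exact .refl _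
  | second a b l => exact .swap b a l

/-- The larger active rank is at least half of the active sum, hence at least `r - 3/2`, hence at
least `r - 1`. This is why the larger one is moved up. -/
theorem Detach.replaces {cs seg rest : List (VTree K)} (h : Detach cs seg rest) {r : ℕ}
    (hr : 2 * (r : ℤ) ≤ activeSum (cs.map VTree.rank) + 3) :
    Replaces r (seg.map VTree.rank) := by
  cases h with
  | none => exact .inl ⟨rfl, by simp [activeSum] at hr; omega⟩
  | only a => exact .inr ⟨_, rfl, by simp [activeSum] at hr; omega⟩
  | last a b l => exact .inr ⟨_, rfl, by simp [activeSum] at hr; omega⟩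
  | second a b l => exact .inr ⟨_, rfl, by simp [activeSum] at hr; omega⟩

theorem Detach.nodePotential_le {cs seg rest : List (VTree K)} (h : Detach cs seg rest) (r : ℕ) :
    nodePotential (recalc rest) (rest.map VTree.rank) ≤
      nodePotential r (cs.map VTree.rank) + 29 := by
  have hb := recalc_bounds rest
  cases h with
  | none =>
    have := ViolationHeap.nodePotential_le (recalc ([] : List (VTree K))) []
    simp only [List.map_nil, surplus_nil] at this ⊢
    omega
  | only a => exact nodePotential_unlink (.inl ⟨_, rfl⟩) r _ hb.1 hb.2
  | last a b l => exact nodePotential_unlink (.inl ⟨_, rfl⟩) r _ hb.1 hb.2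
  | second a b l => exact nodePotential_unlink (.inr ⟨_, _, _, rfl, rfl⟩) r _ hb.1 hb.2

variable [LinearOrder K]

/-- What is put in the position of the subtree `t` when `t` is cut, or when its rank is updated:
one tree, whose rank is smaller by at most one, or none, if `t` has rank `0`. -/
def ReplacesTree (t : VTree K) (seg : List (VTree K)) : Prop :=
  Replaces t.rank (seg.map VTree.rank) ∧ ∀ s ∈ seg, Valid s ∧ t.key ≤ s.key

theorem valid_fill {f : Frame K} {seg : List (VTree K)} :
    Valid (f.fill seg) ↔ 2 * (f.rank : ℤ) ≤ activeSum ((f.kids seg).map VTree.rank) + 3 ∧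
      (∀ c ∈ f.newer ++ f.older, f.key ≤ c.key ∧ Valid c) ∧
      ∀ c ∈ seg, f.key ≤ c.key ∧ Valid c := by
  rw [Frame.fill, valid_node, Frame.kids]
  simp only [List.mem_append]
  grind

theorem Valid.of_plug {t : VTree K} {fs : List (Frame K)} (h : Valid (plug t fs)) : Valid t := by
  induction fs generalizing t with
  | nil => exact h
  | cons f fs ih => exact ((valid_fill.1 (ih h)).2.2 t (by simp)).2

theorem Valid.head_key_le {a s : VTree K} {fs : List (Frame K)} (h : Valid (plug a fs))
    (hs : s.key = a.key) : ∀ g ∈ fs.head?, g.key ≤ s.key := by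
  rcases fs with _ | ⟨g, gs⟩
  · simp
  · have hg := valid_fill.1 (Valid.of_plug (fs := gs) h)
    have := (hg.2.2 _ (List.mem_singleton_self _)).1
    rw [← hs] at this
    simpa using this

theorem Valid.plug_congr {a b : VTree K} {fs : List (Frame K)} (h : Valid (plug a fs))
    (hb : Valid b) (hr : b.rank = a.rank) (hk : ∀ f ∈ fs.head?, f.key ≤ b.key) :
    Valid (plug b fs) := by
  induction fs generalizing a b with
  | nil => exact hb
  | cons f fs ih =>
    have hf := valid_fill.1 (Valid.of_plug (fs := fs) h)
    refine ih (a := f.fill [a]) h (valid_fill.2 ⟨?_, hf.2.1, ?_⟩) rfl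
      (Valid.head_key_le (a := f.fill [a]) h rfl)
    · rw [map_rank_kids] at hf ⊢
      simpa [hr] using hf.1
    · simpa using ⟨hk f rfl, hb⟩

/-- The propagation of rank updates keeps the trees well-formed, and the number of visited nodes
is paid for by the decrease of the potential. -/
theorem climb_spec {t : VTree K} {seg : List (VTree K)} {fs : List (Frame K)}
    (hv : Valid (plug t fs)) (hseg : ReplacesTree t seg) :
    (∀ s ∈ (climb seg fs).1, Valid s) ∧
      ((climb seg fs).1.map potential).sum + (climb seg fs).2 + potential t ≤
        potential (plug t fs) + (seg.map potential).sum + 26 := by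
  induction fs generalizing t seg with
  | nil =>
    refine ⟨fun s hs => (hseg.2 s hs).1, ?_⟩
    simp only [climb, plug]
    omega
  | cons f fs ih =>
    have hf := valid_fill.1 (Valid.of_plug (fs := fs) hv)
    have hft := hf.2.2 t (by simp)
    have hkeys : ∀ c ∈ seg, f.key ≤ c.key ∧ Valid c := fun c hc =>
      ⟨hft.1.trans (hseg.2 c hc).2, (hseg.2 c hc).1⟩
    have hrk := hf.1
    rw [map_rank_kids] at hrk
    simp only [List.map_cons, List.map_nil, List.cons_append, List.nil_append] at hrk
    have hpt : potential (f.fill [t]) = nodePotential f.rank (f.newer.map VTree.rank ++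
        (t.rank :: f.older.map VTree.rank)) + (f.newer.map potential).sum +
        (f.older.map potential).sum + potential t := by
      rw [Frame.fill, potential_node, map_rank_kids]
      simp [Frame.kids]
      ring
    have hps : ∀ r : ℕ, potential (VTree.node f.elt f.key r (f.kids seg)) =
        nodePotential r (f.newer.map VTree.rank ++ (seg.map VTree.rank ++
        f.older.map VTree.rank)) + (f.newer.map potential).sum +
        (f.older.map potential).sum + (seg.map potential).sum := by
      intro r
      rw [potential_node, map_rank_kids]
      simp [Frame.kids]
      ring
    have hb := recalc_bounds (f.kids seg)
    rw [map_rank_kids] at hb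
    -- Where the traversal stops, one last node potential grows by at most 25 and at most one more
    -- node is visited: together the 26 of the statement.
    have halted : 2 * (f.rank : ℤ) ≤ activeSum ((f.kids seg).map VTree.rank) + 3 → ∀ d ≤ 1,
        (∀ s ∈ [plug (f.fill seg) fs], Valid s) ∧
          ([plug (f.fill seg) fs].map potential).sum + d + potential t ≤
            potential (plug t (f :: fs)) + (seg.map potential).sum + 26 := by
      intro hr d hd
      constructor
      · simp only [List.mem_singleton, forall_eq]
        exact Valid.plug_congr (a := f.fill [t]) (fs := fs) hv
          (valid_fill.2 ⟨hr, hf.2.1, hkeys⟩) rfl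
          (Valid.head_key_le (a := f.fill [t]) (fs := fs) hv rfl)
      · have h1 := potential_plug_congr (a := f.fill [t]) (b := f.fill seg) rfl fs
        have h2 := nodePotential_replace hseg.1 f.rank (f.newer.map VTree.rank)
          (f.older.map VTree.rank)
        have h3 := hps f.rank
        simp only [List.map_cons, List.map_nil, List.sum_cons, List.sum_nil, plug]
        rw [← Frame.fill] at h3
        omega
    rw [climb]
    split_ifs with hact hlt
    · dsimp only
      obtain ⟨h1, h2⟩ := nodePotential_update hseg.1 hrk hlt hb.1
      -- The updated parent replaces the old one with rank smaller by exactly one, so the induction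
      -- hypothesis applies one level up. The unit released in `h1` pays for this visit.
      obtain ⟨h3, h4⟩ := ih (t := f.fill [t])
        (seg := [VTree.node f.elt f.key (recalc (f.kids seg)) (f.kids seg)]) hv
        ⟨.inr ⟨_, rfl, h2.le⟩, by
          simp only [List.mem_singleton, forall_eq]
          refine ⟨valid_node.2 ⟨(recalc_bounds _).2, ?_, ?_⟩, le_rfl⟩
          · have := hf.2.1
            simp only [Frame.kids, List.mem_append] at this ⊢
            grind
          · have := hf.2.1
            simp only [Frame.kids, List.mem_append] at this ⊢
            grind⟩
      refine ⟨h3, ?_⟩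
      have h5 := hps (recalc (f.kids seg))
      simp only [List.map_cons, List.map_nil, List.sum_cons, List.sum_nil] at h4
      simp only [plug]
      omega
    · refine halted ?_ 1 le_rfl
      rw [map_rank_kids]
      omega
    · refine halted ?_ 0 (Nat.zero_le _)
      -- In an inactive position the replacement leaves the active sum of the parent unchanged.
      have h2 : 2 ≤ (f.newer.map VTree.rank).length := by
        simpa [Frame.Active, Nat.succ_le_iff] using hact
      rw [map_rank_kids, activeSum_append_of_two_le h2]
      rwa [activeSum_append_of_two_le h2] at hrk

/-! ### Adding a root, and melding -/

theorem addRoot_perm (t : VTree K) (h : Heap K) : (addRoot t h).Perm (t :: h) := by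
  rcases h with _ | ⟨f, fs⟩
  · exact .refl _
  · rw [addRoot]
    split_ifs
    · exact .refl _
    · exact .swap _ _ _

theorem HeapValid.addRoot {t : VTree K} {h : Heap K} (hv : HeapValid h) (ht : Valid t) :
    HeapValid (addRoot t h) := by
  refine ⟨fun s hs => ?_, ?_⟩
  · rcases List.mem_cons.1 ((addRoot_perm t h).mem_iff.1 hs) with rfl | hs
    · exact ht
    · exact hv.1 s hs
  · rcases h with _ | ⟨f, fs⟩
    · simp [ViolationHeap.addRoot]
    · have h2 := hv.2 f rfl
      rw [ViolationHeap.addRoot]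
      split_ifs with hlt
      · rintro _ ⟨⟩ s hs
        rcases List.mem_cons.1 hs with rfl | hs
        · exact le_rfl
        · exact hlt.le.trans (h2 s hs)
      · rintro _ ⟨⟩ s hs
        simp only [List.mem_cons] at hs h2
        rcases hs with rfl | rfl | hs
        · exact le_rfl
        · exact not_lt.1 hlt
        · exact h2 s (.inr hs)

/-- Replacing a tree of a heap by a tree with the same root key. -/
theorem HeapValid.replace {pre post : Heap K} {s t : VTree K}
    (hv : HeapValid (pre ++ s :: post)) (ht : Valid t) (hk : t.key = s.key) :
    HeapValid (pre ++ t :: post) := by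
  constructor
  · intro a ha
    simp only [List.mem_append, List.mem_cons] at ha
    rcases ha with ha | rfl | ha
    · exact hv.1 a (by simp [ha])
    · exact ht
    · exact hv.1 a (by simp [ha])
  · have h2 := hv.2
    rcases pre with _ | ⟨p, pre⟩
    · simp only [List.nil_append, List.head?_cons, Option.mem_some_iff, forall_eq',
        List.mem_cons, forall_eq_or_imp, le_refl, true_and, hk] at h2 ⊢
      exact h2
    · simp only [List.cons_append, List.head?_cons, Option.mem_some_iff, forall_eq',
        List.mem_cons, List.mem_append, forall_eq_or_imp, le_refl, true_and] at h2 ⊢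
      rintro a (ha | rfl | ha)
      · exact h2 a (.inl ha)
      · rw [hk]; exact h2 s (.inr (.inl rfl))
      · exact h2 a (.inr (.inr ha))

theorem Meld.perm {h₁ h₂ h : Heap K} (hm : Meld h₁ h₂ h) : h.Perm (h₁ ++ h₂) := by
  cases hm with
  | nil_left => exact .refl _
  | nil_right => simp
  | left a b as bs => exact .refl _
  | right a b as bs => exact List.perm_append_comm (l₁ := b :: bs)

theorem Meld.valid {h₁ h₂ h : Heap K} (hm : Meld h₁ h₂ h) (hv₁ : HeapValid h₁)
    (hv₂ : HeapValid h₂) : HeapValid h := by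
  refine ⟨fun s hs => ?_, ?_⟩
  · rcases List.mem_append.1 (hm.perm.mem_iff.1 hs) with hs | hs
    · exact hv₁.1 s hs
    · exact hv₂.1 s hs
  · have hp := hm.perm
    cases hm with
    | nil_left => exact hv₂.2
    | nil_right => exact hv₁.2
    | left a b as bs hab =>
      rintro _ ⟨⟩ s hs
      rcases List.mem_append.1 (hp.mem_iff.1 hs) with hs | hs
      · exact hv₁.2 _ rfl s hs
      · exact hab.trans (hv₂.2 _ rfl s hs)
    | right a b as bs hab =>
      rintro _ ⟨⟩ s hs
      rcases List.mem_append.1 (hp.mem_iff.1 hs) with hs | hs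
      · exact hab.trans (hv₁.2 _ rfl s hs)
      · exact hv₂.2 _ rfl s hs

theorem Meld.exists (h₁ h₂ : Heap K) : ∃ h, Meld h₁ h₂ h := by
  rcases h₁ with _ | ⟨a, as⟩
  · exact ⟨_, .nil_left _⟩
  rcases h₂ with _ | ⟨b, bs⟩
  · exact ⟨_, .nil_right _⟩
  rcases le_total a.key b.key with h | h
  · exact ⟨_, .left a b as bs h⟩
  · exact ⟨_, .right a b as bs h⟩

end Paths

/-! ### Single operations on a collection of heaps -/

section Main

variable {K : Type u}

theorem contents_middle (pre post : Heap K) (l : Heap K) :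
    contents (pre ++ l ++ post) = contents l + (contents pre + contents post) := by
  rw [contents_append, contents_append]
  abel

/-- The potential of the heaps with names in `S`. -/
noncomputable def storePotential (S : Finset ℕ) (σ : Store K) : ℕ := ∑ g ∈ S, heapPotential (σ g)

theorem storePotential_update {S : Finset ℕ} {h : ℕ} (hh : h ∈ S) (σ : Store K) (h' : Heap K) :
    storePotential S (Function.update σ h h') + heapPotential (σ h) =
      storePotential S σ + heapPotential h' := by
  rw [storePotential, storePotential, ← Finset.add_sum_erase _ _ hh,
    ← Finset.add_sum_erase (a := h) S (fun g => heapPotential (σ g)) hh]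
  have : ∑ g ∈ S.erase h, heapPotential (Function.update σ h h' g) =
      ∑ g ∈ S.erase h, heapPotential (σ g) :=
    Finset.sum_congr rfl fun g hg => by
      rw [Function.update_of_ne (Finset.ne_of_mem_erase hg)]
  rw [this, Function.update_self]
  ring

variable [AddCommGroup K] [LinearOrder K]

/-! ### Decrease-key -/

theorem DecreaseKey.exists {δ : K} {x : ℕ} {h : Heap K} (hx : Stored x h) :
    ∃ c h', DecreaseKey δ x h c h' := by
  obtain ⟨k, hk⟩ := hx
  obtain ⟨t, ht, hk⟩ := mem_contents.1 hk
  obtain ⟨r, cs, fs, rfl⟩ := exists_plug_of_mem hk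
  obtain ⟨pre, post, rfl⟩ := List.append_of_mem ht
  rcases fs with _ | ⟨f, fs⟩
  · obtain ⟨m, hm⟩ : ∃ m, m ∈ (pre ++ VTree.node x k r cs :: post).head? := by
      rcases pre with _ | ⟨a, l⟩ <;> simp
    rcases lt_or_ge (k - δ) m.key with hlt | hle
    · exact ⟨_, _, .root_first _ pre post k r cs rfl ⟨m, hm, hlt⟩⟩
    · exact ⟨_, _, .root_stay _ pre post k r cs rfl ⟨m, hm, hle⟩⟩
  · by_cases hc : f.Active ∧ f.key ≤ k - δ
    · exact ⟨_, _, .unmoved _ pre post k r cs f fs rfl hc.1 hc.2⟩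
    · obtain ⟨seg, rest, hd⟩ := exists_detach cs
      exact ⟨_, _, .cut _ pre post k r cs seg rest f fs rfl hc hd⟩

theorem DecreaseKey.contents_eq {δ : K} {x c : ℕ} {h h' : Heap K}
    (hd : DecreaseKey δ x h c h') :
    ∃ k s, contents h = (x, k) ::ₘ s ∧ contents h' = (x, k - δ) ::ₘ s := by
  have mid : ∀ (pre post : Heap K) (t : VTree K),
      contents (pre ++ t :: post) = contents [t] + (contents pre + contents post) := by
    intro pre post t
    rw [← contents_middle]
    simp
  cases hd with
  | root_first pre post k r cs hh _ =>
    subst hh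
    refine ⟨k, contents cs + (contents pre + contents post), ?_, ?_⟩
    · rw [mid, contents_node, Multiset.cons_add]
    · rw [contents_cons, contents_node, contents_append, Multiset.cons_add]
  | root_stay pre post k r cs hh _ =>
    subst hh
    refine ⟨k, contents cs + (contents pre + contents post), ?_, ?_⟩ <;>
      rw [mid, contents_node, Multiset.cons_add]
  | unmoved pre post k r cs f fs hh _ _ =>
    subst hh
    refine ⟨k, contents cs + pathContents (f :: fs) + (contents pre + contents post), ?_, ?_⟩ <;>
      rw [mid, contents_plug, contents_node, Multiset.cons_add, Multiset.cons_add]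
  | cut pre post k r cs seg rest f fs hh _ hdt =>
    subst hh
    refine ⟨k, contents cs + pathContents (f :: fs) + (contents pre + contents post), ?_, ?_⟩
    · rw [mid, contents_plug, contents_node, Multiset.cons_add, Multiset.cons_add]
    · rw [contents_perm (addRoot_perm _ _), contents_cons, contents_node, contents_middle,
        contents_climb, contents_perm hdt.perm, contents_append, Multiset.cons_add]
      congr 1
      abel

theorem DecreaseKey.valid [IsOrderedAddMonoid K] {δ : K} {x c : ℕ} {h h' : Heap K}
    (hd : DecreaseKey δ x h c h') (hδ : 0 ≤ δ) (hv : HeapValid h) : HeapValid h' := by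
  have hsub : ∀ k : K, k - δ ≤ k := fun k => sub_le_self k hδ
  have hroot : ∀ {k : K} {r : ℕ} {cs : List (VTree K)}, Valid (VTree.node x k r cs) →
      Valid (VTree.node x (k - δ) r cs) := fun {k r cs} ht => by
    rw [valid_node] at ht ⊢
    exact ⟨ht.1, fun c hc => (hsub k).trans (ht.2.1 c hc), ht.2.2⟩
  cases hd with
  | root_first pre post k r cs hh hm =>
    subst hh
    obtain ⟨m, hm, hlt⟩ := hm
    have h2 := hv.2 m hm
    constructor
    · intro a ha
      rcases List.mem_cons.1 ha with rfl | ha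
      · exact hroot (hv.1 _ (by simp))
      · refine hv.1 a ?_
        simp only [List.mem_append, List.mem_cons] at ha ⊢
        tauto
    · rintro _ ⟨⟩ a ha
      rcases List.mem_cons.1 ha with rfl | ha
      · exact le_rfl
      · refine hlt.le.trans (h2 a ?_)
        simp only [List.mem_append, List.mem_cons] at ha ⊢
        tauto
  | root_stay pre post k r cs hh hm =>
    subst hh
    obtain ⟨m, hm, hle⟩ := hm
    have h2 := hv.2 m hm
    constructor
    · intro a ha
      simp only [List.mem_append, List.mem_cons] at ha
      rcases ha with ha | rfl | ha
      · exact hv.1 a (by simp [ha])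
      · exact hroot (hv.1 _ (by simp))
      · exact hv.1 a (by simp [ha])
    · have h3 : ∀ a ∈ pre ++ VTree.node x (k - δ) r cs :: post, m.key ≤ a.key := by
        intro a ha
        simp only [List.mem_append, List.mem_cons] at ha
        rcases ha with ha | rfl | ha
        · exact h2 a (by simp [ha])
        · exact hle
        · exact h2 a (by simp [ha])
      rcases pre with _ | ⟨p, pre⟩
      -- Here `x` is the first root itself, and its new key is below its old one.
      · rintro _ ⟨⟩ a ha
        obtain rfl : VTree.node x k r cs = m := by simpa using hm
        exact (hsub k).trans (h3 a ha)
      · rintro _ ⟨⟩ a ha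
        obtain rfl : p = m := by simpa using hm
        exact h3 a ha
  | unmoved pre post k r cs f fs hh _ hle =>
    subst hh
    have ht := hv.1 (plug (VTree.node x k r cs) (f :: fs)) (by simp)
    refine hv.replace (ht.plug_congr (hroot (ht.of_plug)) rfl ?_)
      (plug_key_congr (a := f.fill [VTree.node x (k - δ) r cs])
        (b := f.fill [VTree.node x k r cs]) rfl fs)
    simpa using hle
  | cut pre post k r cs seg rest f fs hh _ hdt =>
    subst hh
    have ht := hv.1 (plug (VTree.node x k r cs) (f :: fs)) (by simp)
    have hx := valid_node.1 ht.of_plug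
    have hmem : ∀ c, c ∈ cs ↔ c ∈ seg ∨ c ∈ rest := fun c => by
      rw [hdt.perm.mem_iff, List.mem_append]
    have hrep : ReplacesTree (VTree.node x k r cs) seg :=
      ⟨hdt.replaces hx.1, fun s hs =>
        ⟨hx.2.2 s ((hmem s).2 (.inl hs)), hx.2.1 s ((hmem s).2 (.inl hs))⟩⟩
    obtain ⟨w, hw, hwk⟩ := climb_cons_eq seg f fs (VTree.node x k r cs)
    have hcl := (climb_spec ht hrep).1
    rw [hw] at hcl ⊢
    refine HeapValid.addRoot ?_ (valid_node.2 ⟨(recalc_bounds rest).2, fun c hc =>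
      (hsub k).trans (hx.2.1 c ((hmem c).2 (.inr hc))), fun c hc =>
      hx.2.2 c ((hmem c).2 (.inr hc))⟩)
    simpa using hv.replace (hcl w (by simp)) hwk

theorem DecreaseKey.cost_le {δ : K} {x c : ℕ} {h h' : Heap K} (hd : DecreaseKey δ x h c h')
    (hv : HeapValid h) : c + heapPotential h' ≤ heapPotential h + 100 := by
  have mid : ∀ (pre post : Heap K) (t : VTree K), heapPotential (pre ++ t :: post) =
      potential t + 3 + heapPotential pre + heapPotential post := by
    intro pre post t
    rw [heapPotential_append, heapPotential_cons]
    ring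
  cases hd with
  | root_first pre post k r cs hh _ =>
    subst hh
    rw [mid, heapPotential_cons, heapPotential_append, potential_node, potential_node]
    omega
  | root_stay pre post k r cs hh _ =>
    subst hh
    rw [mid, mid, potential_node, potential_node]
    omega
  | unmoved pre post k r cs f fs hh _ _ =>
    subst hh
    have h1 := potential_plug_congr (a := VTree.node x k r cs) (b := VTree.node x (k - δ) r cs)
      rfl (f :: fs)
    rw [potential_node, potential_node] at h1
    rw [mid, mid]
    omega
  | cut pre post k r cs seg rest f fs hh _ hdt =>
    subst hh
    have ht := hv.1 (plug (VTree.node x k r cs) (f :: fs)) (by simp)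
    have hx := valid_node.1 ht.of_plug
    have hrep : ReplacesTree (VTree.node x k r cs) seg :=
      ⟨hdt.replaces hx.1, fun s hs =>
        have hs' : s ∈ cs := hdt.perm.mem_iff.2 (List.mem_append_left _ hs)
        ⟨hx.2.2 s hs', hx.2.1 s hs'⟩⟩
    obtain ⟨w, hw, -⟩ := climb_cons_eq seg f fs (VTree.node x k r cs)
    -- The propagation costs at most 26, the detached child at most 29, the new root 3 and the fixed
    -- work 1.
    have h1 := (climb_spec ht hrep).2
    have h2 := hdt.nodePotential_le r
    have h3 := (hdt.perm.map potential).sum_eq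
    rw [heapPotential_perm (addRoot_perm _ _), heapPotential_cons, List.append_assoc,
      hw, List.singleton_append, mid, mid, potential_node]
    rw [hw, potential_node] at h1
    simp only [List.map_append, List.sum_append, List.map_cons, List.map_nil, List.sum_cons,
      List.sum_nil] at h1 h3
    omega

/-! ### Sequences of operations -/

/-- The names of the heaps that an operation refers to. -/
def Op.heaps : Op K → Finset ℕ
  | .findMin h => {h}
  | .insert h _ _ => {h}
  | .meld h₁ h₂ => {h₁, h₂}
  | .decreaseKey h _ _ => {h}
  | .deleteMin h => {h}

variable {σ σ' : Store K} {o : Op K} {r : Option (ℕ × K)} {c : ℕ}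

theorem Step.valid [IsOrderedAddMonoid K] (hs : Step σ o r c σ') (hv : ∀ g, HeapValid (σ g)) :
    ∀ g, HeapValid (σ' g) := by
  have upd : ∀ (τ : Store K) (h : ℕ) (h' : Heap K), (∀ g, HeapValid (τ g)) → HeapValid h' →
      ∀ g, HeapValid (Function.update τ h h' g) := by
    intro τ h h' hτ hh' g
    rw [Function.update_apply]
    split_ifs
    · exact hh'
    · exact hτ g
  cases hs with
  | findMin h t ts _ => exact hv
  | insert h x k _ =>
    exact upd _ _ _ hv ((hv h).addRoot (valid_node.2 ⟨by simp [activeSum], by simp, by simp⟩))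
  | meld h₁ h₂ h _ hm =>
    exact upd _ _ _ (upd _ _ _ hv (hm.valid (hv h₁) (hv h₂))) ⟨by simp, by simp⟩
  | decreaseKey h x δ c h' ha hd => exact upd _ _ _ hv (hd.valid ha.2 (hv h))
  | deleteMin h z c h' hd => exact upd _ _ _ hv (hd.valid (hv h))

theorem Step.correct (hs : Step σ o r c σ') (hv : ∀ g, HeapValid (σ g)) :
    o.Correct σ r σ' := by
  have hfirst : ∀ (h : ℕ) (t : VTree K) (ts : List (VTree K)), σ h = t :: ts →
      ∀ q ∈ contents (σ h), t.key ≤ q.2 := by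
    intro h t ts ht
    have := hv h
    rw [ht] at this ⊢
    exact this.key_le
  cases hs with
  | findMin h t ts ht =>
    refine ⟨rfl, (t.elt, t.key), ?_, rfl, hfirst h t ts ht⟩
    rw [ht]
    obtain ⟨e, k, r, cs⟩ := t
    rw [contents_cons, contents_node]
    simp
  | insert h x k _ =>
    refine ⟨?_, fun g hg => Function.update_of_ne hg _ _⟩
    rw [Function.update_self, contents_perm (addRoot_perm _ _), contents_cons, contents_node,
      contents_nil, Multiset.cons_add, zero_add]
  | meld h₁ h₂ h hne hm =>
    refine ⟨?_, ?_, fun g h1 h2 => ?_⟩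
    · rw [Function.update_of_ne hne, Function.update_self, contents_perm hm.perm,
        contents_append]
    · rw [Function.update_self, contents_nil]
    · rw [Function.update_of_ne h2, Function.update_of_ne h1]
  | decreaseKey h x δ c h' _ hd =>
    refine ⟨?_, fun g hg => Function.update_of_ne hg _ _⟩
    rw [Function.update_self]
    exact hd.contents_eq
  | deleteMin h z c h' hd =>
    refine ⟨⟨_, rfl, ?_, ?_⟩, fun g hg => Function.update_of_ne hg _ _⟩
    · rw [Function.update_self]
      exact hd.contents_eq
    · have hz : ∃ ts, σ h = z :: ts := by
        generalize σ h = h₀ at hd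
        cases hd
        exact ⟨_, rfl⟩
      obtain ⟨ts, hts⟩ := hz
      exact hfirst h z ts hts

theorem Step.exists (ha : o.Admissible σ) : ∃ r c σ', Step σ o r c σ' := by
  cases o with
  | findMin h =>
    obtain ⟨t, ts, ht⟩ := List.exists_cons_of_ne_nil ha
    exact ⟨_, _, _, .findMin σ h t ts ht⟩
  | insert h x k => exact ⟨_, _, _, .insert σ h x k ha⟩
  | meld h₁ h₂ =>
    obtain ⟨h, hm⟩ := Meld.exists (σ h₁) (σ h₂)
    exact ⟨_, _, _, .meld σ h₁ h₂ h ha hm⟩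
  | decreaseKey h x δ =>
    obtain ⟨c, h', hd⟩ := DecreaseKey.exists (δ := δ) ha.1
    exact ⟨_, _, _, .decreaseKey σ h x δ c h' ha hd⟩
  | deleteMin h =>
    obtain ⟨t, ts, ht⟩ := List.exists_cons_of_ne_nil ha
    obtain ⟨c, h', hd⟩ := DeleteMin.exists t ts
    exact ⟨_, _, _, .deleteMin σ h t c h' (ht ▸ hd)⟩

theorem Step.cost_le (hs : Step σ o r c σ') (hv : ∀ g, HeapValid (σ g)) {S : Finset ℕ}
    (hS : o.heaps ⊆ S) :
    (c : ℝ) + storePotential S σ' ≤ storePotential S σ + 100 * o.amortized σ := by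
  have const : c + storePotential S σ' ≤ storePotential S σ + 100 →
      (c : ℝ) + storePotential S σ' ≤ storePotential S σ + 100 * 1 := by
    intro h
    rw [mul_one]
    exact_mod_cast h
  cases hs with
  | findMin h t ts _ => exact const (by omega)
  | insert h x k _ =>
    refine const ?_
    have h1 := storePotential_update (hS (Finset.mem_singleton_self h)) σ
      (addRoot (VTree.node x k 0 []) (σ h))
    rw [heapPotential_perm (addRoot_perm _ _), heapPotential_cons, potential_node] at h1
    have h2 := nodePotential_le 0 []
    rw [surplus_nil] at h2
    simp only [List.map_nil, List.sum_nil] at h1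
    omega
  | meld h₁ h₂ h hne hm =>
    refine const ?_
    have h1 := storePotential_update (hS (by simp [Op.heaps] : h₁ ∈ _)) σ h
    have h2 := storePotential_update (hS (by simp [Op.heaps] : h₂ ∈ _))
      (Function.update σ h₁ h) []
    rw [Function.update_of_ne (Ne.symm hne), heapPotential_nil] at h2
    rw [heapPotential_perm hm.perm, heapPotential_append] at h1
    omega
  | decreaseKey h x δ c h' _ hd =>
    refine const ?_
    have h1 := storePotential_update (hS (Finset.mem_singleton_self h)) σ h'
    have h2 := hd.cost_le (hv h)
    omega
  | deleteMin h z c h' hd =>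
    have h1 : (storePotential S (Function.update σ h h') : ℝ) + heapPotential (σ h) =
        storePotential S σ + heapPotential h' := by
      exact_mod_cast storePotential_update (hS (Finset.mem_singleton_self h)) σ h'
    have h2 := hd.cost_le (hv h)
    simp only [Op.amortized]
    linarith

end Main

end ViolationHeap

/-! ### Summation over a run -/

open ViolationHeap in
theorem theorem1 :
    ∃ C : ℝ, ∀ (K : Type u) [AddCommGroup K] [LinearOrder K] [IsOrderedAddMonoid K]
      (m : ℕ) (σ : ℕ → Store K) (op : ℕ → Op K) (out : ℕ → Option (ℕ × K)) (cost : ℕ → ℕ),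
      IsRun m σ op out cost →
        (∀ i < m, (op i).Correct (σ i) (out i) (σ (i + 1))) ∧
        (∀ o : Op K, o.Admissible (σ m) → ∃ r c σ', Step (σ m) o r c σ') ∧
        ∑ i ∈ Finset.range m, (cost i : ℝ) ≤
          ∑ i ∈ Finset.range m, C * (op i).amortized (σ i) := by
  refine ⟨100, fun K _ _ _ m σ op out cost hrun => ?_⟩
  have hv : ∀ i ≤ m, ∀ g, HeapValid (σ i g) := by
    intro i
    induction i with
    | zero =>
      intro _ g
      rw [hrun.1 g]
      exact ⟨by simp, by simp⟩
    | succ i ih => exact fun hi => (hrun.2 i hi).valid (ih (Nat.le_of_succ_le hi))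
  refine ⟨fun i hi => (hrun.2 i hi).correct (hv i hi.le), fun o => Step.exists, ?_⟩
  -- Only finitely many names occur in the run, which makes the total potential a finite sum.
  let S : Finset ℕ := (Finset.range m).biUnion fun i => (op i).heaps
  have key : ∀ n ≤ m, ∑ i ∈ Finset.range n, (cost i : ℝ) + storePotential S (σ n) ≤
      ∑ i ∈ Finset.range n, 100 * (op i).amortized (σ i) := by
    intro n
    induction n with
    | zero => simp [storePotential, hrun.1, heapPotential_nil]
    | succ n ih =>
      intro hn
      have h1 := ih (Nat.le_of_succ_le hn)
      have h2 := (hrun.2 n hn).cost_le (hv n (Nat.le_of_succ_le hn)) (S := S)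
        (Finset.subset_biUnion_of_mem (fun i => (op i).heaps) (Finset.mem_range.2 hn))
      rw [Finset.sum_range_succ, Finset.sum_range_succ]
      linarith
  have h1 := key m le_rfl
  have h2 : (0 : ℝ) ≤ storePotential S (σ m) := Nat.cast_nonneg _
  linarith
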